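/- Let $\Delta_T$ be the Laplacian of the triangular lattice acting on $\ell^2(\mathbb Z^2)$ (the lattice point $n_1v_1+n_2v_2$, with $v_1=(1,0)$ and $v_2=(\tfrac12,\tfrac{\sqrt3}{2})$, being identified with $n=(n_1,n_2)$): $$(\Delta_Tf)(n)=\tfrac16\big(f(n_1+1,n_2)+f(n_1-1,n_2)+f(n_1,n_2+1)+f(n_1,n_2-1)+f(n_1+1,n_2-1)+f(n_1-1,n_2+1)\big).$$ Let $A$ be the closure in $\ell^2(\mathbb Z^2)$ of the operator defined on the rapidly decreasing sequences $\mathcal S=\{f:\mathbb Z^2\to\mathbb C:\ \sup_n|(1+n_1^2+n_2^2)^Nf(n)|<\infty\ \text{for all } N\in\mathbb N\}$ by $$Af(n)=\tfrac{i}{6}\Big((n_1+\tfrac12)f(n_1+1,n_2)-(n_1-\tfrac12)f(n_1-1,n_2)+(n_2+\tfrac12)f(n_1,n_2+1)-(n_2-\tfrac12)f(n_1,n_2-1)$$ $$\qquad\qquad+(n_2-n_1+1)f(n_1-1,n_2+1)+(n_1-n_2+1)f(n_1+1,n_2-1)\Big).$$ Let $\mathcal F:\ell^2(\mathbb Z^2)\to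 L^2([-\pi,\pi]^2)$, $\mathcal Ff(x)=\frac1{2\pi}\sum_nf(n)e^{-i\langle n,x\rangle}$, be the (unitary) Fourier transform, let $\Delta_{\mathcal F}=\mathcal F\Delta_T\mathcal F^{-1}$, let $F(x)=\frac13(\cos x_1+\cos x_2+\cos(x_1-x_2))$, and let $\widehat A$ be the closure in $L^2([-\pi,\pi]^2)$ of the operator $\frac i2(\nabla F\cdot\nabla+\nabla\cdot\nabla F)$ defined on the $C^\infty$ functions that are $2\pi$-periodic in each variable. For a self-adjoint operator $B$ and a bounded operator $H$ on a Hilbert space $\mathcal H$, write $H\in\mathcal C^2(B)$ if for every $f\in\mathcal H$ the map $\mathbb R\ni t\mapsto e^{itB}He^{-itB}f\in\mathcal H$ is of class $C^2$. Then $\Delta_{\mathcal F}$ is the operator of multiplication by $F$, the unitary groups $(e^{it\widehat A})_{t\in\mathbb R}$ and $(e^{itA})_{t\in\mathbb R}$ exist (equivalently, $\widehat A$ and $A$ are self-adjoint), and $$\Delta_{\mathcal F}\in\mathcal C^2(\widehat A)\qquad\text{and}\qquad\Delta_T\in\mathcal C^2(A).$$ -/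

import Mathlib

noncomputable section

namespace TriLattice

open MeasureTheory Complex
open scoped ContDiff ENNReal

/-! ## Regularity of a bounded operator with respect to a self-adjoint operator -/

section Regularity

variable {E : Type*} [NormedAddCommGroup E] [InnerProductSpace ℂ E] [CompleteSpace E]

/-- `U` is the strongly continuous one-parameter unitary group `t ↦ e^{itA}`: the vectors `f` in the
domain of `A` are exactly those for which `t ↦ U t f` is differentiable at `0`, and the derivative
there is `i A f`. (By Stone's theorem such a `U` exists if and only if `A` is self-adjoint, and it
is then unique.) -/
structure IsUnitaryGroupOf (U : ℝ → E →L[ℂ] E) (A : E →ₗ.[ℂ] E) : Prop where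
  zero : U 0 = 1
  add : ∀ s t : ℝ, U (s + t) = U s * U t
  unitary : ∀ t : ℝ, U t ∈ unitary (E →L[ℂ] E)
  continuous : ∀ f : E, Continuous fun t : ℝ => U t f
  mem_domain_iff : ∀ f : E, f ∈ A.domain ↔ DifferentiableAt ℝ (fun t : ℝ => U t f) 0
  hasDerivAt : ∀ f : A.domain, HasDerivAt (fun t : ℝ => U t (f : E)) (I • A f) 0

/-- The class `C^k(A)`, for a bounded operator `H` and a self-adjoint operator `A`: the map
`t ↦ e^{itA} H e^{-itA} f` is of class `C^k` on `ℝ` for every vector `f`. -/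
def IsOfClass (k : ℕ) (H : E →L[ℂ] E) (A : E →ₗ.[ℂ] E) : Prop :=
  ∃ U : ℝ → E →L[ℂ] E, IsUnitaryGroupOf U A ∧
    ∀ f : E, ContDiff ℝ k fun t : ℝ => U t (H (U (-t) f))

end Regularity

/-! ## The lattice side -/

/-- `ℓ²(ℤ²)`, the vertex `n₁ v₁ + n₂ v₂` of the triangular lattice being identified
with `(n₁, n₂)`. -/
abbrev L2Lattice : Type := lp (fun _ : ℤ × ℤ => ℂ) 2

lemma memlp_shift (v : ℤ × ℤ) (f : L2Lattice) :
    Memℓp (fun n : ℤ × ℤ => (f : ℤ × ℤ → ℂ) (n + v)) 2 := by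
  have h := (memℓp_gen_iff (by norm_num)).1 (lp.memℓp f)
  exact (memℓp_gen_iff (by norm_num)).2 ((Equiv.addRight v).summable_iff.2 h)

/-- The translation `f ↦ f(· + v)` on `ℓ²(ℤ²)`. -/
def shift (v : ℤ × ℤ) : L2Lattice →ₗᵢ[ℂ] L2Lattice where
  toFun f := ⟨fun n => (f : ℤ × ℤ → ℂ) (n + v), memlp_shift v f⟩
  map_add' f g := by ext n; rfl
  map_smul' c f := by ext n; rfl
  norm_map' f := by
    rw [lp.norm_eq_tsum_rpow (by norm_num), lp.norm_eq_tsum_rpow (by norm_num)]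
    congr 1
    exact (Equiv.addRight v).tsum_eq (fun n => ‖(f : ℤ × ℤ → ℂ) n‖ ^ (2 : ℝ≥0∞).toReal)

/-- The Laplacian `Δ_T` of the triangular lattice: the mean over the six neighbours
`n ± v₁`, `n ± v₂`, `n ± (v₁ - v₂)`. -/
def laplacian : L2Lattice →L[ℂ] L2Lattice :=
  (1 / 6 : ℂ) •
    ((shift (1, 0)).toContinuousLinearMap + (shift (-1, 0)).toContinuousLinearMap +
      (shift (0, 1)).toContinuousLinearMap + (shift (0, -1)).toContinuousLinearMap +
      (shift (1, -1)).toContinuousLinearMap + (shift (-1, 1)).toContinuousLinearMap)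

/-- Rapidly decreasing functions on `ℤ²`. -/
def rapid : Submodule ℂ (ℤ × ℤ → ℂ) where
  carrier := {f | ∀ N : ℕ, ∃ C : ℝ, ∀ n : ℤ × ℤ,
    ‖(1 + (n.1 : ℂ) ^ 2 + (n.2 : ℂ) ^ 2) ^ N * f n‖ ≤ C}
  zero_mem' N := ⟨0, fun n => by simp⟩
  add_mem' {f g} hf hg N := by
    obtain ⟨C, hC⟩ := hf N
    obtain ⟨D, hD⟩ := hg N
    refine ⟨C + D, fun n => ?_⟩
    rw [Pi.add_apply, mul_add]
    exact (norm_add_le _ _).trans (add_le_add (hC n) (hD n))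
  smul_mem' c f hf N := by
    obtain ⟨C, hC⟩ := hf N
    refine ⟨‖c‖ * C, fun n => ?_⟩
    rw [Pi.smul_apply, smul_eq_mul, mul_left_comm, norm_mul]
    exact mul_le_mul_of_nonneg_left (hC n) (norm_nonneg _)

lemma norm_weight (n : ℤ × ℤ) :
    ‖(1 + (n.1 : ℂ) ^ 2 + (n.2 : ℂ) ^ 2)‖ = 1 + (n.1 : ℝ) ^ 2 + (n.2 : ℝ) ^ 2 := by
  have : (1 + (n.1 : ℂ) ^ 2 + (n.2 : ℂ) ^ 2) = ((1 + (n.1 : ℝ) ^ 2 + (n.2 : ℝ) ^ 2 : ℝ) : ℂ) := by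
    push_cast; rfl
  rw [this, Complex.norm_real, Real.norm_of_nonneg (by positivity)]

lemma rapid_mul_fst {f : ℤ × ℤ → ℂ} (hf : f ∈ rapid) :
    (fun n : ℤ × ℤ => (n.1 : ℂ) * f n) ∈ rapid := by
  intro N
  obtain ⟨C, hC⟩ := hf (N + 1)
  refine ⟨C, fun n => le_trans ?_ (hC n)⟩
  have h1 : ‖(n.1 : ℂ)‖ ≤ 1 + (n.1 : ℝ) ^ 2 + (n.2 : ℝ) ^ 2 := by
    rw [Complex.norm_intCast]
    nlinarith [sq_abs (n.1 : ℝ), sq_nonneg (|(n.1 : ℝ)| - 1), sq_nonneg (n.2 : ℝ)]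
  rw [norm_mul, norm_mul, norm_mul, norm_pow, norm_pow, norm_weight, pow_succ _ N, mul_assoc]
  gcongr

lemma rapid_mul_snd {f : ℤ × ℤ → ℂ} (hf : f ∈ rapid) :
    (fun n : ℤ × ℤ => (n.2 : ℂ) * f n) ∈ rapid := by
  intro N
  obtain ⟨C, hC⟩ := hf (N + 1)
  refine ⟨C, fun n => le_trans ?_ (hC n)⟩
  have h1 : ‖(n.2 : ℂ)‖ ≤ 1 + (n.1 : ℝ) ^ 2 + (n.2 : ℝ) ^ 2 := by
    rw [Complex.norm_intCast]
    nlinarith [sq_abs (n.2 : ℝ), sq_nonneg (|(n.2 : ℝ)| - 1), sq_nonneg (n.1 : ℝ)]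
  rw [norm_mul, norm_mul, norm_mul, norm_pow, norm_pow, norm_weight, pow_succ _ N, mul_assoc]
  gcongr

lemma rapid_shift {f : ℤ × ℤ → ℂ} (hf : f ∈ rapid) (v : ℤ × ℤ) :
    (fun n : ℤ × ℤ => f (n + v)) ∈ rapid := by
  intro N
  obtain ⟨C, hC⟩ := hf N
  set w : ℝ := 1 + (v.1 : ℝ) ^ 2 + (v.2 : ℝ) ^ 2 with hw
  refine ⟨(2 * w) ^ N * C, fun n => ?_⟩
  have hle : 1 + (n.1 : ℝ) ^ 2 + (n.2 : ℝ) ^ 2 ≤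
      2 * w * (1 + ((n + v).1 : ℝ) ^ 2 + ((n + v).2 : ℝ) ^ 2) := by
    simp only [Prod.fst_add, Prod.snd_add, Int.cast_add, hw]
    nlinarith [sq_nonneg ((n.1 : ℝ) + 2 * v.1), sq_nonneg ((n.2 : ℝ) + 2 * v.2),
      mul_nonneg (sq_nonneg (v.1 : ℝ)) (sq_nonneg ((n.1 : ℝ) + v.1)),
      mul_nonneg (sq_nonneg (v.1 : ℝ)) (sq_nonneg ((n.2 : ℝ) + v.2)),
      mul_nonneg (sq_nonneg (v.2 : ℝ)) (sq_nonneg ((n.1 : ℝ) + v.1)),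
      mul_nonneg (sq_nonneg (v.2 : ℝ)) (sq_nonneg ((n.2 : ℝ) + v.2))]
  have hCn := hC (n + v)
  rw [norm_mul, norm_pow, norm_weight] at hCn ⊢
  calc (1 + (n.1 : ℝ) ^ 2 + (n.2 : ℝ) ^ 2) ^ N * ‖f (n + v)‖
      ≤ (2 * w * (1 + ((n + v).1 : ℝ) ^ 2 + ((n + v).2 : ℝ) ^ 2)) ^ N * ‖f (n + v)‖ := by gcongr
    _ = (2 * w) ^ N * ((1 + ((n + v).1 : ℝ) ^ 2 + ((n + v).2 : ℝ) ^ 2) ^ N * ‖f (n + v)‖) := by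
        rw [mul_pow]; ring
    _ ≤ (2 * w) ^ N * C := by gcongr

lemma summable_inv_sq : Summable fun k : ℤ => (1 + (k : ℝ) ^ 2)⁻¹ := by
  have h : Summable fun k : ℤ => 1 / (k : ℝ) ^ 2 := Real.summable_one_div_int_pow.2 (by norm_num)
  refine Summable.of_norm_bounded_eventually h ?_
  have hne : ∀ᶠ k : ℤ in Filter.cofinite, k ≠ 0 := by
    simpa using (Set.finite_singleton (0 : ℤ)).compl_mem_cofinite
  filter_upwards [hne] with k hk
  have : (0 : ℝ) < (k : ℝ) ^ 2 := by positivity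
  rw [Real.norm_of_nonneg (by positivity), one_div]
  gcongr
  linarith

lemma memlp_of_rapid {f : ℤ × ℤ → ℂ} (hf : f ∈ rapid) : Memℓp f 2 := by
  obtain ⟨C, hC⟩ := hf 1
  rw [memℓp_gen_iff (by norm_num)]
  have hs : Summable fun n : ℤ × ℤ => C ^ 2 * ((1 + (n.1 : ℝ) ^ 2)⁻¹ * (1 + (n.2 : ℝ) ^ 2)⁻¹) :=
    (summable_inv_sq.mul_of_nonneg summable_inv_sq (fun k => by positivity)
      (fun k => by positivity)).mul_left _
  refine Summable.of_nonneg_of_le (fun n => by positivity) (fun n => ?_) hs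
  have h := hC n
  rw [pow_one, norm_mul, norm_weight] at h
  simp only [ENNReal.toReal_ofNat, Real.rpow_ofNat]
  rw [← mul_inv, ← div_eq_mul_inv, le_div_iff₀ (by positivity)]
  have h2 := pow_le_pow_left₀ (by positivity) h 2
  have h3 : (1 + (n.1 : ℝ) ^ 2) * (1 + (n.2 : ℝ) ^ 2) ≤
      (1 + (n.1 : ℝ) ^ 2 + (n.2 : ℝ) ^ 2) ^ 2 := by
    nlinarith [sq_nonneg (n.1 : ℝ), sq_nonneg (n.2 : ℝ),
      mul_nonneg (sq_nonneg (n.1 : ℝ)) (sq_nonneg (n.2 : ℝ))]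
  nlinarith [sq_nonneg ‖f n‖]

/-- The discrete Schwartz space `𝒮`, as a subspace of `ℓ²(ℤ²)`. -/
def schwartz : Submodule ℂ L2Lattice :=
  rapid.comap ({ toFun := fun f => (f : ℤ × ℤ → ℂ)
                 map_add' := fun _ _ => rfl
                 map_smul' := fun _ _ => rfl } : L2Lattice →ₗ[ℂ] (ℤ × ℤ → ℂ))

/-- The formal expression of the conjugate operator. With `(U_j f)(n) = f(n - e_j)` it is
`(i/6) [(Q₁ + 1/2) U₁* - (Q₁ - 1/2) U₁ + (Q₂ + 1/2) U₂* - (Q₂ - 1/2) U₂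
  + (Q₂ - Q₁ + 1) U₁ U₂* + (Q₁ - Q₂ + 1) U₁* U₂]`. -/
def conjFun : (ℤ × ℤ → ℂ) →ₗ[ℂ] (ℤ × ℤ → ℂ) where
  toFun f n := I / 6 *
    (((n.1 : ℂ) + 1 / 2) * f (n + (1, 0)) - ((n.1 : ℂ) - 1 / 2) * f (n + (-1, 0))
      + ((n.2 : ℂ) + 1 / 2) * f (n + (0, 1)) - ((n.2 : ℂ) - 1 / 2) * f (n + (0, -1))
      + ((n.2 : ℂ) - (n.1 : ℂ) + 1) * f (n + (-1, 1))
      + ((n.1 : ℂ) - (n.2 : ℂ) + 1) * f (n + (1, -1)))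
  map_add' f g := by ext n; simp only [Pi.add_apply]; ring
  map_smul' c f := by ext n; simp only [Pi.smul_apply, smul_eq_mul, RingHom.id_apply]; ring

lemma conjFun_mem {f : ℤ × ℤ → ℂ} (hf : f ∈ rapid) : conjFun f ∈ rapid := by
  have key : ∀ (a b c : ℂ) (v : ℤ × ℤ),
      (fun n : ℤ × ℤ => (a * (n.1 : ℂ) + b * (n.2 : ℂ) + c) * f (n + v)) ∈ rapid := by
    intro a b c v
    have hs := rapid_shift hf v
    have h := rapid.add_mem (rapid.add_mem (rapid.smul_mem a (rapid_mul_fst hs))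
      (rapid.smul_mem b (rapid_mul_snd hs))) (rapid.smul_mem c hs)
    convert! h using 1
    ext n
    simp only [Pi.add_apply, Pi.smul_apply, smul_eq_mul]
    ring
  have h := rapid.smul_mem (I / 6) (rapid.add_mem (rapid.add_mem (rapid.add_mem (rapid.add_mem
    (rapid.add_mem (key 1 0 (1 / 2) (1, 0)) (key (-1) 0 (1 / 2) (-1, 0)))
    (key 0 1 (1 / 2) (0, 1))) (key 0 (-1) (1 / 2) (0, -1)))
    (key (-1) 1 1 (-1, 1))) (key 1 (-1) 1 (1, -1)))
  convert! h using 1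
  ext n
  simp only [conjFun, LinearMap.coe_mk, AddHom.coe_mk, Pi.add_apply, Pi.smul_apply, smul_eq_mul]
  ring

/-- The conjugate operator on `𝒮`. -/
def conjCore : L2Lattice →ₗ.[ℂ] L2Lattice where
  domain := schwartz
  toFun :=
    { toFun := fun f => ⟨conjFun (f : L2Lattice), memlp_of_rapid (conjFun_mem f.2)⟩
      map_add' := fun f g => by
        ext n
        exact congrFun (conjFun.map_add ((f : L2Lattice) : ℤ × ℤ → ℂ) ((g : L2Lattice) : _)) n
      map_smul' := fun c f => by
        ext n
        exact congrFun (conjFun.map_smul c ((f : L2Lattice) : ℤ × ℤ → ℂ)) n }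

/-- The conjugate operator `A` in `ℓ²(ℤ²)`: the closure of its restriction to `𝒮`. -/
def conjugateOp : L2Lattice →ₗ.[ℂ] L2Lattice := conjCore.closure

/-! ## The Fourier side -/

/-- The square `[-π, π]²`. -/
def box : Set (ℝ × ℝ) := Set.Icc (-Real.pi) Real.pi ×ˢ Set.Icc (-Real.pi) Real.pi

/-- Lebesgue measure on `[-π, π]²`. -/
def boxMeasure : Measure (ℝ × ℝ) := volume.restrict box

/-- `L²([-π, π]²)`. -/
abbrev L2Box : Type := Lp ℂ 2 boxMeasure

lemma isCompact_box : IsCompact box := isCompact_Icc.prod isCompact_Icc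

instance : IsFiniteMeasure boxMeasure :=
  isFiniteMeasure_restrict.2 isCompact_box.measure_lt_top.ne

lemma memLp_box {g : ℝ × ℝ → ℂ} (hg : Continuous g) : MemLp g 2 boxMeasure := by
  obtain ⟨C, hC⟩ := isCompact_box.exists_bound_of_continuousOn hg.continuousOn
  refine MemLp.of_bound hg.aestronglyMeasurable C ?_
  exact (ae_restrict_iff' isCompact_box.measurableSet).2 (Filter.Eventually.of_forall hC)

/-- The class in `L²([-π, π]²)` of a continuous function. -/
def toL2 : C(ℝ × ℝ, ℂ) →ₗ[ℂ] L2Box where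
  toFun g := (memLp_box g.continuous).toLp g
  map_add' _ _ := rfl
  map_smul' _ _ := rfl

lemma coeFn_toL2 (g : C(ℝ × ℝ, ℂ)) : toL2 g =ᵐ[boxMeasure] g :=
  (memLp_box g.continuous).coeFn_toLp

/-- The function `x ↦ (2π)⁻¹ e^{-i⟨n, x⟩}`. -/
def expFun (n : ℤ × ℤ) : C(ℝ × ℝ, ℂ) where
  toFun x := (1 / (2 * Real.pi) : ℂ) * exp (-I * ((n.1 : ℂ) * x.1 + (n.2 : ℂ) * x.2))

/-- The symbol `F(x) = (cos x₁ + cos x₂ + cos (x₁ - x₂)) / 3`. -/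
def symbol (x : ℝ × ℝ) : ℝ := (Real.cos x.1 + Real.cos x.2 + Real.cos (x.1 - x.2)) / 3

/-- `∂₁`. -/
def pd₁ (g : ℝ × ℝ → ℂ) (x : ℝ × ℝ) : ℂ := fderiv ℝ g x (1, 0)

/-- `∂₂`. -/
def pd₂ (g : ℝ × ℝ → ℂ) (x : ℝ × ℝ) : ℂ := fderiv ℝ g x (0, 1)

/-- The symbol as a complex-valued function. -/
def symbolC (x : ℝ × ℝ) : ℂ := (symbol x : ℂ)

/-- The smooth functions that are `2π`-periodic in each variable. -/
def smoothPer : Submodule ℂ (ℝ × ℝ → ℂ) where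
  carrier := {g | ContDiff ℝ ∞ g ∧ (∀ x y : ℝ, g (x + 2 * Real.pi, y) = g (x, y)) ∧
    ∀ x y : ℝ, g (x, y + 2 * Real.pi) = g (x, y)}
  zero_mem' := ⟨contDiff_const, fun _ _ => rfl, fun _ _ => rfl⟩
  add_mem' {f g} hf hg := ⟨hf.1.add hg.1, fun x y => by simp [hf.2.1 x y, hg.2.1 x y],
    fun x y => by simp [hf.2.2 x y, hg.2.2 x y]⟩
  smul_mem' c f hf := ⟨contDiff_const.smul hf.1, fun x y => by simp [hf.2.1 x y],
    fun x y => by simp [hf.2.2 x y]⟩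

/-- The differential expression `(i/2) (∇F · ∇ + ∇ · ∇F)`. -/
def conjHatFun (g : ℝ × ℝ → ℂ) (x : ℝ × ℝ) : ℂ :=
  I / 2 * ((pd₁ symbolC x * pd₁ g x + pd₂ symbolC x * pd₂ g x)
    + (pd₁ (fun y => pd₁ symbolC y * g y) x + pd₂ (fun y => pd₂ symbolC y * g y) x))

lemma contDiff_symbolC : ContDiff ℝ ∞ symbolC := by
  have : ContDiff ℝ ∞ symbol := by unfold symbol; fun_prop
  exact Complex.ofRealCLM.contDiff.comp this

lemma contDiff_pd₁ {g : ℝ × ℝ → ℂ} (hg : ContDiff ℝ ∞ g) : ContDiff ℝ ∞ (pd₁ g) :=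
  (hg.fderiv_right (m := ∞) (by simp)).clm_apply contDiff_const

lemma contDiff_pd₂ {g : ℝ × ℝ → ℂ} (hg : ContDiff ℝ ∞ g) : ContDiff ℝ ∞ (pd₂ g) :=
  (hg.fderiv_right (m := ∞) (by simp)).clm_apply contDiff_const

lemma contDiff_conjHatFun {g : ℝ × ℝ → ℂ} (hg : ContDiff ℝ ∞ g) :
    ContDiff ℝ ∞ (conjHatFun g) := by
  have h1 := contDiff_pd₁ contDiff_symbolC
  have h2 := contDiff_pd₂ contDiff_symbolC
  exact contDiff_const.mul (((h1.mul (contDiff_pd₁ hg)).add (h2.mul (contDiff_pd₂ hg))).add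
    ((contDiff_pd₁ (h1.mul hg)).add (contDiff_pd₂ (h2.mul hg))))

lemma pd₁_add {f g : ℝ × ℝ → ℂ} (hf : ContDiff ℝ ∞ f) (hg : ContDiff ℝ ∞ g) (x : ℝ × ℝ) :
    pd₁ (fun y => f y + g y) x = pd₁ f x + pd₁ g x := by
  unfold pd₁
  rw [fderiv_fun_add (hf.differentiable (by simp) x) (hg.differentiable (by simp) x)]; rfl

lemma pd₂_add {f g : ℝ × ℝ → ℂ} (hf : ContDiff ℝ ∞ f) (hg : ContDiff ℝ ∞ g) (x : ℝ × ℝ) :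
    pd₂ (fun y => f y + g y) x = pd₂ f x + pd₂ g x := by
  unfold pd₂
  rw [fderiv_fun_add (hf.differentiable (by simp) x) (hg.differentiable (by simp) x)]; rfl

lemma pd₁_smul {f : ℝ × ℝ → ℂ} (hf : ContDiff ℝ ∞ f) (c : ℂ) (x : ℝ × ℝ) :
    pd₁ (fun y => c * f y) x = c * pd₁ f x := by
  unfold pd₁
  rw [fderiv_const_mul (hf.differentiable (by simp) x)]; rfl

lemma pd₂_smul {f : ℝ × ℝ → ℂ} (hf : ContDiff ℝ ∞ f) (c : ℂ) (x : ℝ × ℝ) :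
    pd₂ (fun y => c * f y) x = c * pd₂ f x := by
  unfold pd₂
  rw [fderiv_const_mul (hf.differentiable (by simp) x)]; rfl

lemma conjHatFun_add {f g : ℝ × ℝ → ℂ} (hf : ContDiff ℝ ∞ f) (hg : ContDiff ℝ ∞ g)
    (x : ℝ × ℝ) : conjHatFun (f + g) x = conjHatFun f x + conjHatFun g x := by
  have h1 := contDiff_pd₁ contDiff_symbolC
  have h2 := contDiff_pd₂ contDiff_symbolC
  have e1 : pd₁ (fun y => pd₁ symbolC y * (f + g) y) x =
      pd₁ (fun y => pd₁ symbolC y * f y) x + pd₁ (fun y => pd₁ symbolC y * g y) x := by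
    rw [← pd₁_add (h1.mul hf) (h1.mul hg)]; simp only [Pi.add_apply, mul_add]
  have e2 : pd₂ (fun y => pd₂ symbolC y * (f + g) y) x =
      pd₂ (fun y => pd₂ symbolC y * f y) x + pd₂ (fun y => pd₂ symbolC y * g y) x := by
    rw [← pd₂_add (h2.mul hf) (h2.mul hg)]; simp only [Pi.add_apply, mul_add]
  have e3 : pd₁ (f + g) x = pd₁ f x + pd₁ g x := pd₁_add hf hg x
  have e4 : pd₂ (f + g) x = pd₂ f x + pd₂ g x := pd₂_add hf hg x
  unfold conjHatFun
  rw [e1, e2, e3, e4]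
  ring

lemma conjHatFun_smul {f : ℝ × ℝ → ℂ} (hf : ContDiff ℝ ∞ f) (c : ℂ)
    (x : ℝ × ℝ) : conjHatFun (c • f) x = c * conjHatFun f x := by
  have h1 := contDiff_pd₁ contDiff_symbolC
  have h2 := contDiff_pd₂ contDiff_symbolC
  have e1 : pd₁ (fun y => pd₁ symbolC y * (c • f) y) x =
      c * pd₁ (fun y => pd₁ symbolC y * f y) x := by
    rw [← pd₁_smul (h1.mul hf)]; simp only [Pi.smul_apply, smul_eq_mul, mul_left_comm]
  have e2 : pd₂ (fun y => pd₂ symbolC y * (c • f) y) x =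
      c * pd₂ (fun y => pd₂ symbolC y * f y) x := by
    rw [← pd₂_smul (h2.mul hf)]; simp only [Pi.smul_apply, smul_eq_mul, mul_left_comm]
  have e3 : pd₁ (c • f) x = c * pd₁ f x := pd₁_smul hf c x
  have e4 : pd₂ (c • f) x = c * pd₂ f x := pd₂_smul hf c x
  unfold conjHatFun
  rw [e1, e2, e3, e4]
  ring

/-- The class in `L²([-π, π]²)` of a smooth periodic function. -/
def smoothPerToL2 : smoothPer →ₗ[ℂ] L2Box where
  toFun g := toL2 ⟨g, g.2.1.continuous⟩
  map_add' _ _ := rfl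
  map_smul' _ _ := rfl

/-- `g ↦ (i/2) (∇F · ∇ + ∇ · ∇F) g`, from smooth periodic functions to `L²([-π, π]²)`. -/
def conjHatToL2 : smoothPer →ₗ[ℂ] L2Box where
  toFun g := toL2 ⟨conjHatFun g, (contDiff_conjHatFun g.2.1).continuous⟩
  map_add' f g := by
    rw [← map_add]
    congr 1
    ext x
    exact conjHatFun_add f.2.1 g.2.1 x
  map_smul' c f := by
    rw [RingHom.id_apply, ← map_smul]
    congr 1
    ext x
    exact conjHatFun_smul f.2.1 c x

lemma box_subset_closure_interior : box ⊆ closure (interior box) := by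
  have h : (-Real.pi) ≠ Real.pi := by linarith [Real.pi_pos]
  rw [box, interior_prod_eq, closure_prod_eq, interior_Icc, closure_Ioo h]

lemma smoothPerToL2_injective : Function.Injective smoothPerToL2 := by
  intro f g hfg
  have h1 : (f : ℝ × ℝ → ℂ) =ᵐ[boxMeasure] (g : ℝ × ℝ → ℂ) := by
    have hf := coeFn_toL2 ⟨f, f.2.1.continuous⟩
    have hg := coeFn_toL2 ⟨g, g.2.1.continuous⟩
    have he : toL2 ⟨f, f.2.1.continuous⟩ = toL2 ⟨g, g.2.1.continuous⟩ := hfg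
    rw [he] at hf
    exact hf.symm.trans hg
  have h2 : Set.EqOn (f : ℝ × ℝ → ℂ) g box :=
    Measure.eqOn_of_ae_eq h1 f.2.1.continuous.continuousOn g.2.1.continuous.continuousOn
      box_subset_closure_interior
  have p1 : ∀ (h : smoothPer) (y : ℝ),
      Function.Periodic (fun x => (h : ℝ × ℝ → ℂ) (x, y)) (2 * Real.pi) := fun h y x => h.2.2.1 x y
  have p2 : ∀ (h : smoothPer) (x : ℝ),
      Function.Periodic (fun y => (h : ℝ × ℝ → ℂ) (x, y)) (2 * Real.pi) := fun h x y => h.2.2.2 x y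
  have hmem : ∀ x : ℝ, toIcoMod Real.two_pi_pos (-Real.pi) x ∈ Set.Icc (-Real.pi) Real.pi := by
    intro x
    have := toIcoMod_mem_Ico Real.two_pi_pos (-Real.pi) x
    exact ⟨this.1, by linarith [this.2]⟩
  have hred : ∀ (h : smoothPer) (x y : ℝ), (h : ℝ × ℝ → ℂ) (x, y) =
      (h : ℝ × ℝ → ℂ) (toIcoMod Real.two_pi_pos (-Real.pi) x,
        toIcoMod Real.two_pi_pos (-Real.pi) y) := by
    intro h x y
    rw [toIcoMod, toIcoMod]
    have e1 := (p1 h (y - toIcoDiv Real.two_pi_pos (-Real.pi) y • (2 * Real.pi))).sub_zsmul_eq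
      (x := x) (toIcoDiv Real.two_pi_pos (-Real.pi) x)
    have e2 := (p2 h x).sub_zsmul_eq (x := y) (toIcoDiv Real.two_pi_pos (-Real.pi) y)
    exact (e1.trans e2).symm
  ext ⟨x, y⟩
  rw [hred f, hred g]
  exact h2 ⟨hmem x, hmem y⟩

/-- The operator `Â` on the smooth periodic functions. -/
def conjHatCore : L2Box →ₗ.[ℂ] L2Box where
  domain := LinearMap.range smoothPerToL2
  toFun := conjHatToL2 ∘ₗ
    (LinearEquiv.ofInjective smoothPerToL2 smoothPerToL2_injective).symm.toLinearMap

/-- The operator `Â` in `L²([-π, π]²)`: the closure of its restriction to the smooth periodic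
functions. -/
def conjugateOpHat : L2Box →ₗ.[ℂ] L2Box := conjHatCore.closure

/-! ## The Fourier transform -/

/-- The Haar probability measure of the torus `(ℝ / ℤ)²`. -/
def torusMeasure : Measure (UnitAddTorus (Fin 2)) :=
  Measure.pi fun _ : Fin 2 => (AddCircle.haarAddCircle : Measure UnitAddCircle)

instance : IsProbabilityMeasure torusMeasure := by unfold torusMeasure; infer_instance

/-- The projection `x ↦ (x₁ / 2π, x₂ / 2π)` of the plane onto the torus. -/
def toTorus (x : ℝ × ℝ) : UnitAddTorus (Fin 2) :=
  MeasurableEquiv.finTwoArrow.symm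
    (Prod.map (fun t : ℝ => (((2 * Real.pi)⁻¹ * t : ℝ) : UnitAddCircle))
      (fun t : ℝ => (((2 * Real.pi)⁻¹ * t : ℝ) : UnitAddCircle)) x)

lemma measurable_toCircle :
    Measurable fun t : ℝ => (((2 * Real.pi)⁻¹ * t : ℝ) : UnitAddCircle) :=
  AddCircle.measurable_mk'.comp (measurable_const_mul _)

lemma measurable_toTorus : Measurable toTorus :=
  MeasurableEquiv.finTwoArrow.symm.measurable.comp
    (measurable_toCircle.prodMap measurable_toCircle)

lemma map_toCircle :
    (volume.restrict (Set.Icc (-Real.pi) Real.pi)).map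
      (fun t : ℝ => (((2 * Real.pi)⁻¹ * t : ℝ) : UnitAddCircle)) =
      ENNReal.ofReal (2 * Real.pi) • (AddCircle.haarAddCircle : Measure UnitAddCircle) := by
  have hpi := Real.pi_pos
  have h1 := (UnitAddCircle.measurePreserving_mk (-(1 / 2))).map_eq
  have h2 : (volume : Measure UnitAddCircle) = AddCircle.haarAddCircle := by
    rw [AddCircle.volume_eq_smul_haarAddCircle, ENNReal.ofReal_one, one_smul]
  have h3 : (volume.restrict (Set.Icc (-Real.pi) Real.pi)).map (fun t : ℝ => (2 * Real.pi)⁻¹ * t) =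
      ENNReal.ofReal (2 * Real.pi) • volume.restrict (Set.Ioc (-(1 / 2)) (-(1 / 2) + 1)) := by
    have hpre : (fun t : ℝ => (2 * Real.pi)⁻¹ * t) ⁻¹' (Set.Ioc (-(1 / 2)) (-(1 / 2) + 1)) =
        Set.Ioc (-Real.pi) Real.pi := by
      ext t
      simp only [Set.mem_preimage, Set.mem_Ioc, inv_mul_eq_div]
      rw [lt_div_iff₀ (by positivity), div_le_iff₀ (by positivity)]
      constructor <;> rintro ⟨a, b⟩ <;> constructor <;> linarith
    rw [← Measure.restrict_smul, ← Measure.restrict_congr_set (Ioc_ae_eq_Icc (μ := volume)), ← hpre,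
      ← Measure.restrict_map (measurable_const_mul _) measurableSet_Ioc,
      Real.map_volume_mul_left (by positivity), inv_inv, abs_of_pos (by positivity)]
  have h4 : (fun t : ℝ => (((2 * Real.pi)⁻¹ * t : ℝ) : UnitAddCircle)) =
      (fun t : ℝ => (t : UnitAddCircle)) ∘ fun t : ℝ => (2 * Real.pi)⁻¹ * t := rfl
  rw [h4, ← Measure.map_map AddCircle.measurable_mk' (measurable_const_mul _), h3,
    Measure.map_smul, h1, h2]

lemma map_toTorus :
    boxMeasure.map toTorus = ENNReal.ofReal (4 * Real.pi ^ 2) • torusMeasure := by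
  have h1 : boxMeasure = (volume.restrict (Set.Icc (-Real.pi) Real.pi)).prod
      (volume.restrict (Set.Icc (-Real.pi) Real.pi)) := by
    rw [Measure.prod_restrict]; rfl
  have h2 := (measurePreserving_finTwoArrow
    (AddCircle.haarAddCircle : Measure UnitAddCircle)).symm.map_eq
  have h3 : toTorus = MeasurableEquiv.finTwoArrow.symm ∘
      Prod.map (fun t : ℝ => (((2 * Real.pi)⁻¹ * t : ℝ) : UnitAddCircle))
        (fun t : ℝ => (((2 * Real.pi)⁻¹ * t : ℝ) : UnitAddCircle)) := rfl
  rw [h3, ← Measure.map_map MeasurableEquiv.finTwoArrow.symm.measurable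
    (measurable_toCircle.prodMap measurable_toCircle), h1,
    ← Measure.map_prod_map _ _ measurable_toCircle measurable_toCircle, map_toCircle,
    Measure.prod_smul_left, Measure.prod_smul_right, smul_smul, Measure.map_smul, h2,
    ← ENNReal.ofReal_mul (by positivity)]
  congr 2
  ring

lemma integral_comp_toTorus {G : UnitAddTorus (Fin 2) → ℂ}
    (hG : AEStronglyMeasurable G torusMeasure) :
    ∫ x, G (toTorus x) ∂boxMeasure = (4 * Real.pi ^ 2 : ℂ) * ∫ y, G y ∂torusMeasure := by
  have hG' : AEStronglyMeasurable G (boxMeasure.map toTorus) := by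
    rw [map_toTorus]; exact hG.smul_measure _
  rw [← integral_map measurable_toTorus.aemeasurable hG', map_toTorus, integral_smul_measure,
    ENNReal.toReal_ofReal (by positivity), Complex.real_smul]
  push_cast
  ring

lemma expFun_eq (n : ℤ × ℤ) (x : ℝ × ℝ) : expFun n x =
    (1 / (2 * Real.pi) : ℂ) * UnitAddTorus.mFourier (-![n.1, n.2]) (toTorus x) := by
  have hpi : (Real.pi : ℂ) ≠ 0 := by exact_mod_cast Real.pi_ne_zero
  have e0 : toTorus x 0 = (((2 * Real.pi)⁻¹ * x.1 : ℝ) : UnitAddCircle) := rfl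
  have e1 : toTorus x 1 = (((2 * Real.pi)⁻¹ * x.2 : ℝ) : UnitAddCircle) := rfl
  simp only [expFun, UnitAddTorus.mFourier, ContinuousMap.coe_mk, Fin.prod_univ_two, e0, e1,
    fourier_coe_apply, Pi.neg_apply, Matrix.cons_val_zero, Matrix.cons_val_one]
  rw [← Complex.exp_add]
  congr 2
  push_cast
  field_simp
  ring

lemma integral_mFourier (k : Fin 2 → ℤ) :
    ∫ y, UnitAddTorus.mFourier k y ∂torusMeasure = if k = 0 then 1 else 0 := by
  have h := orthonormal_iff_ite.1 (UnitAddTorus.orthonormal_mFourier (d := Fin 2)) 0 k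
  rw [ContinuousMap.inner_toLp] at h
  simp only [UnitAddTorus.mFourier_zero, ContinuousMap.one_apply, map_one, mul_one] at h
  refine Eq.trans h ?_
  simp only [eq_comm]

lemma orthonormal_exp : Orthonormal ℂ fun n : ℤ × ℤ => toL2 (expFun n) := by
  have hpi : (Real.pi : ℂ) ≠ 0 := by exact_mod_cast Real.pi_ne_zero
  rw [orthonormal_iff_ite]
  intro m n
  rw [L2.inner_def]
  have h1 : ∫ x, inner ℂ (toL2 (expFun m) x) (toL2 (expFun n) x) ∂boxMeasure =
      ∫ x, (1 / (4 * Real.pi ^ 2) : ℂ) *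
        UnitAddTorus.mFourier (![m.1, m.2] + -![n.1, n.2]) (toTorus x) ∂boxMeasure := by
    refine integral_congr_ae ?_
    filter_upwards [coeFn_toL2 (expFun m), coeFn_toL2 (expFun n)] with x hm hn
    rw [hm, hn, expFun_eq, expFun_eq, UnitAddTorus.mFourier_add, RCLike.inner_apply, map_mul,
      ← UnitAddTorus.mFourier_neg, neg_neg]
    simp only [map_div₀, map_mul, map_one, Complex.conj_ofReal, map_ofNat]
    field_simp
    ring
  rw [h1, integral_const_mul, integral_comp_toTorus
    (UnitAddTorus.mFourier _).continuous.aestronglyMeasurable, integral_mFourier]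
  have hiff : (![m.1, m.2] + -![n.1, n.2] = 0) ↔ m = n := by
    rw [add_neg_eq_zero, Prod.ext_iff]
    constructor
    · intro h; exact ⟨congrFun h 0, congrFun h 1⟩
    · rintro ⟨a, b⟩; rw [a, b]
  simp only [hiff]
  split_ifs
  · field_simp
  · simp

/-- A measurable section of `toTorus` with values in `(-π, π]²`. -/
def ofTorus (y : UnitAddTorus (Fin 2)) : ℝ × ℝ :=
  (2 * Real.pi * (AddCircle.measurableEquivIoc 1 (-(1 / 2)) (y 0) : ℝ),
    2 * Real.pi * (AddCircle.measurableEquivIoc 1 (-(1 / 2)) (y 1) : ℝ))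

lemma measurable_ofTorus : Measurable ofTorus := by
  have h : ∀ i : Fin 2, Measurable fun y : UnitAddTorus (Fin 2) =>
      2 * Real.pi * (AddCircle.measurableEquivIoc 1 (-(1 / 2)) (y i) : ℝ) := fun i =>
    (measurable_subtype_coe.comp ((AddCircle.measurableEquivIoc 1 (-(1 / 2))).measurable.comp
      (measurable_pi_apply i))).const_mul _
  exact (h 0).prodMk (h 1)

lemma ofTorus_toTorus {x : ℝ × ℝ}
    (hx : x ∈ Set.Ioc (-Real.pi) Real.pi ×ˢ Set.Ioc (-Real.pi) Real.pi) :
    ofTorus (toTorus x) = x := by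
  have hpi := Real.pi_pos
  have key : ∀ t ∈ Set.Ioc (-Real.pi) Real.pi, 2 * Real.pi *
      (AddCircle.measurableEquivIoc 1 (-(1 / 2))
        (((2 * Real.pi)⁻¹ * t : ℝ) : UnitAddCircle) : ℝ) = t := by
    intro t ht
    have hm : (2 * Real.pi)⁻¹ * t ∈ Set.Ioc (-(1 / 2) : ℝ) (-(1 / 2) + 1) := by
      simp only [Set.mem_Ioc, inv_mul_eq_div]
      rw [lt_div_iff₀ (by positivity), div_le_iff₀ (by positivity)]
      constructor <;> linarith [ht.1, ht.2]
    have h := (AddCircle.measurableEquivIoc (1 : ℝ) (-(1 / 2))).apply_symm_apply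
      ⟨(2 * Real.pi)⁻¹ * t, hm⟩
    have h' := congrArg Subtype.val h
    have h'' : ((AddCircle.measurableEquivIoc 1 (-(1 / 2))
        (((2 * Real.pi)⁻¹ * t : ℝ) : UnitAddCircle) : _) : ℝ) = (2 * Real.pi)⁻¹ * t := h'
    rw [h'']
    field_simp
  exact Prod.ext (key _ hx.1) (key _ hx.2)

lemma ae_mem_Ioc :
    ∀ᵐ x ∂boxMeasure, x ∈ Set.Ioc (-Real.pi) Real.pi ×ˢ Set.Ioc (-Real.pi) Real.pi := by
  have h : boxMeasure =
      volume.restrict (Set.Ioc (-Real.pi) Real.pi ×ˢ Set.Ioc (-Real.pi) Real.pi) := by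
    refine Measure.restrict_congr_set ?_
    exact (Measure.set_prod_ae_eq Ioc_ae_eq_Icc Ioc_ae_eq_Icc).symm
  rw [h]
  exact ae_restrict_mem (measurableSet_Ioc.prod measurableSet_Ioc)

lemma span_exp_orthogonal :
    (Submodule.span ℂ (Set.range fun n : ℤ × ℤ => toL2 (expFun n)))ᗮ = ⊥ := by
  have hpi : (Real.pi : ℂ) ≠ 0 := by exact_mod_cast Real.pi_ne_zero
  rw [Submodule.eq_bot_iff]
  intro f hf
  have horth : ∀ n : ℤ × ℤ, inner ℂ (toL2 (expFun n)) f = 0 := fun n =>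
    hf _ (Submodule.subset_span ⟨n, rfl⟩)
  have hfm : StronglyMeasurable (f : ℝ × ℝ → ℂ) := Lp.stronglyMeasurable f
  set g : UnitAddTorus (Fin 2) → ℂ := fun y => f (ofTorus y) with hg
  have hgm : StronglyMeasurable g := hfm.comp_measurable measurable_ofTorus
  have hcomp : (fun x => g (toTorus x)) =ᵐ[boxMeasure] f := by
    filter_upwards [ae_mem_Ioc] with x hx
    rw [hg]
    simp only [ofTorus_toTorus hx]
  have hc0 : ENNReal.ofReal (4 * Real.pi ^ 2) ≠ 0 := by
    have := Real.pi_pos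
    rw [Ne, ENNReal.ofReal_eq_zero, not_le]; positivity
  have hgL : MemLp g 2 torusMeasure := by
    have h1 : MemLp (g ∘ toTorus) 2 boxMeasure := (memLp_congr_ae hcomp).2 (Lp.memLp f)
    have h2 := (memLp_map_measure_iff hgm.aestronglyMeasurable
      measurable_toTorus.aemeasurable).2 h1
    rw [map_toTorus] at h2
    have h3 := h2.smul_measure (c := (ENNReal.ofReal (4 * Real.pi ^ 2))⁻¹)
      (ENNReal.inv_ne_top.2 hc0)
    rwa [smul_smul, ENNReal.inv_mul_cancel hc0 ENNReal.ofReal_ne_top, one_smul] at h3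
  have hcoef : ∀ k : Fin 2 → ℤ, ∫ y, UnitAddTorus.mFourier k y * g y ∂torusMeasure = 0 := by
    intro k
    have h1 := horth (k 0, k 1)
    have hk : ![k 0, k 1] = k := by ext i; fin_cases i <;> rfl
    rw [L2.inner_def] at h1
    have h2 : ∫ x, inner ℂ (toL2 (expFun (k 0, k 1)) x) (f x) ∂boxMeasure =
        ∫ x, (1 / (2 * Real.pi) : ℂ) *
          (UnitAddTorus.mFourier k (toTorus x) * g (toTorus x)) ∂boxMeasure := by
      refine integral_congr_ae ?_
      filter_upwards [coeFn_toL2 (expFun (k 0, k 1)), hcomp] with x hx hgx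
      rw [hx, hgx, expFun_eq, RCLike.inner_apply, map_mul, ← UnitAddTorus.mFourier_neg, neg_neg, hk]
      simp only [map_div₀, map_mul, map_one, Complex.conj_ofReal, map_ofNat]
      ring
    rw [h2, integral_const_mul, integral_comp_toTorus
      (G := fun y => UnitAddTorus.mFourier k y * g y)
      ((UnitAddTorus.mFourier k).continuous.aestronglyMeasurable.mul
        hgm.aestronglyMeasurable)] at h1
    have hne : (1 / (2 * Real.pi) : ℂ) ≠ 0 := by simp [hpi]
    have hne2 : (4 * Real.pi ^ 2 : ℂ) ≠ 0 := by simp [hpi]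
    exact (mul_eq_zero.1 ((mul_eq_zero.1 h1).resolve_left hne)).resolve_left hne2
  have hg0 : g =ᵐ[torusMeasure] 0 := by
    have h1 : hgL.toLp g = 0 := by
      refine (LinearIsometryEquiv.map_eq_zero_iff
        (UnitAddTorus.mFourierBasis (d := Fin 2)).repr).1 ?_
      ext k
      refine (UnitAddTorus.mFourierBasis_repr _ k).trans ?_
      refine Eq.trans ?_ (hcoef (-k))
      refine integral_congr_ae ?_
      have h2 : hgL.toLp g =ᵐ[torusMeasure] g := hgL.coeFn_toLp
      filter_upwards [h2] with y hy
      exact congrArg (fun z => UnitAddTorus.mFourier (-k) y * z) hy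
    have h2 : hgL.toLp g =ᵐ[torusMeasure] g := hgL.coeFn_toLp
    rw [h1] at h2
    exact h2.symm.trans (Lp.coeFn_zero ℂ 2 torusMeasure)
  have hg1 : ∀ᵐ y ∂(boxMeasure.map toTorus), g y = 0 := by
    rw [map_toTorus]
    exact Measure.ae_smul_measure hg0 _
  have hg2 := ae_of_ae_map measurable_toTorus.aemeasurable hg1
  rw [Lp.eq_zero_iff_ae_eq_zero]
  filter_upwards [hg2, hcomp] with x h1 h2
  rw [← h2, h1]
  rfl

/-- The orthonormal basis `(2π)⁻¹ e^{-i⟨n, x⟩}`, `n ∈ ℤ²`, of `L²([-π, π]²)`. -/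
def expBasis : HilbertBasis (ℤ × ℤ) ℂ L2Box :=
  HilbertBasis.mkOfOrthogonalEqBot orthonormal_exp span_exp_orthogonal

/-- The Fourier transform `ℱ f(x) = (2π)⁻¹ ∑ₙ f(n) e^{-i⟨n, x⟩}`, a unitary map from `ℓ²(ℤ²)` onto
`L²([-π, π]²)`. -/
def fourierTransform : L2Lattice ≃ₗᵢ[ℂ] L2Box := expBasis.repr.symm

/-- The operator `Δ_ℱ = ℱ Δ_T ℱ⁻¹` on `L²([-π, π]²)`. -/
def laplacianHat : L2Box →L[ℂ] L2Box :=
  fourierTransform.toContinuousLinearEquiv.toContinuousLinearMap ∘L laplacian ∘L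
    fourierTransform.symm.toContinuousLinearEquiv.toContinuousLinearMap

end TriLattice

end

noncomputable section

namespace TriLattice

open MeasureTheory Complex Filter Topology
open scoped ContDiff ENNReal InnerProductSpace

section Stone

variable {E : Type*} [NormedAddCommGroup E] [InnerProductSpace ℂ E]

/-! ## Stone's theorem -/

/-! ### Resolvents of self-adjoint relations. -/

section Resolvent

variable {G : Submodule ℂ (E × E)}

/-! Up to a constant, `A` is the commutator of `Δ_T` with multiplication by `|n|²`: its coefficient
along a neighbour `v` is `(i/12)(|n+v|² - |n|²)`. Everything on the lattice follows from this form
(`conjFun_apply`).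

Self-adjointness: consider the operator given by the same expression on its maximal domain. Its
coefficients grow only linearly in `|n|`, so their commutators with the cutoffs `max 0 (1 -
|n|²/(k+1))` are uniformly bounded and tend to zero pointwise. Hence truncations converge in the
graph norm, the point masses span a core (`maximalGraph_le`), and the maximal operator is its own
adjoint (`adjoint_maximalGraph`). The closure from `𝒮` is caught between the two. Stone's theorem,
proved below through Yosida approximation, then supplies `e^{itA}`.

Regularity: since `|n|²` is quadratic, its mixed second differences are constant, so the commutator
of `A` with a translation is a finite combination of translations with constant coefficients
(`shift_commutator_mem`). The span of the translations contains `Δ_T` and is stable under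
commutation with `A`, so `t ↦ e^{itA} Δ_T e^{-itA} f` can be differentiated as often as desired
(`contDiff_conj`).

Fourier side: integration by parts and the action of `Â` on exponentials show that `ℱ⁻¹` carries `Â`
on smooth periodic functions to the lattice expression. The exponentials are the images of the point
masses, so the core argument also identifies the closures, and the lattice result is transported by
unitary equivalence. -/

lemma inner_symm_of_adjoint_eq (hG : G.adjoint = G) {x z x' z' : E} (h : (x, z) ∈ G)
    (h' : (x', z') ∈ G) : ⟪z, x'⟫_ℂ = ⟪x, z'⟫_ℂ := by
  rw [← hG, Submodule.mem_adjoint_iff] at h'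
  exact sub_eq_zero.1 (h' x z h)

lemma mem_of_adjoint_eq (hG : G.adjoint = G) {f g : E}
    (h : ∀ x z, (x, z) ∈ G → ⟪z, f⟫_ℂ = ⟪x, g⟫_ℂ) : (f, g) ∈ G := by
  rw [← hG, Submodule.mem_adjoint_iff]
  exact fun x z hxz => sub_eq_zero.2 (h x z hxz)

lemma isClosed_of_adjoint_eq (hG : G.adjoint = G) : IsClosed (G : Set (E × E)) := by
  have : (G : Set (E × E)) = ⋂ p ∈ G, {q : E × E | ⟪p.2, q.1⟫_ℂ = ⟪p.1, q.2⟫_ℂ} := by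
    ext q
    simp only [SetLike.mem_coe, Set.mem_iInter, Set.mem_ofPred_eq]
    exact ⟨fun hq p hp => inner_symm_of_adjoint_eq hG hp hq,
      fun h => mem_of_adjoint_eq hG fun x z hxz => h (x, z) hxz⟩
  rw [this]
  exact isClosed_biInter fun p _ => isClosed_eq (by fun_prop) (by fun_prop)

/-- Symmetry makes `⟪z, x⟫` real, so the cross term, the real part of an imaginary multiple of it,
vanishes. Injectivity, closed range and the resolvent bound all come from this identity. -/
lemma norm_sq_add_smul (hG : G.adjoint = G) {x z : E} (h : (x, z) ∈ G) (c : ℝ) :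
    ‖z + (I * c : ℂ) • x‖ ^ 2 = ‖z‖ ^ 2 + c ^ 2 * ‖x‖ ^ 2 := by
  have hs := inner_symm_of_adjoint_eq hG h h
  have him : (⟪z, x⟫_ℂ).im = 0 := by
    have h1 := congrArg Complex.im hs
    rw [← inner_conj_symm x z, Complex.conj_im] at h1
    linarith
  rw [@norm_add_sq ℂ, inner_smul_right, norm_smul]
  simp [him, mul_pow]

lemma norm_le_of_mem (hG : G.adjoint = G) {x z : E} (h : (x, z) ∈ G) {c : ℝ} (hc : c ≠ 0) :
    ‖x‖ ≤ |c|⁻¹ * ‖z + (I * c : ℂ) • x‖ := by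
  have h1 := norm_sq_add_smul hG h c
  have hc' : 0 < |c| := abs_pos.2 hc
  rw [inv_mul_eq_div, le_div_iff₀ hc']
  refine abs_le_of_sq_le_sq' ?_ (norm_nonneg _) |>.2
  rw [mul_pow, sq_abs, h1]
  nlinarith [sq_nonneg ‖z‖]

/-- A self-adjoint relation shifted by a non-zero imaginary number is onto. -/
lemma exists_resolvent_apply [CompleteSpace E] (hG : G.adjoint = G) {c : ℝ} (hc : c ≠ 0) (y : E) :
    ∃ x, (x, y - (I * c : ℂ) • x) ∈ G := by
  have hclosed := isClosed_of_adjoint_eq hG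
  have : CompleteSpace G := hclosed.completeSpace_coe
  let L : G →L[ℂ] E := (ContinuousLinearMap.snd ℂ E E + (I * c : ℂ) •
    ContinuousLinearMap.fst ℂ E E) ∘L G.subtypeL
  have hL : ∀ p : G, L p = (p : E × E).2 + (I * c : ℂ) • (p : E × E).1 := fun p => rfl
  -- Bounded below on a complete space, `L` has closed range; surjectivity reduces to a trivial
  -- orthogonal complement.
  have hanti : AntilipschitzWith (Real.toNNReal (1 + |c|⁻¹)) L := by
    refine ContinuousLinearMap.antilipschitz_of_bound L fun p => ?_
    rw [Real.coe_toNNReal _ (by positivity), hL]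
    have h1 := norm_le_of_mem hG (x := (p : E × E).1) (z := (p : E × E).2) p.2 hc
    have h2 := norm_sq_add_smul hG (x := (p : E × E).1) (z := (p : E × E).2) p.2 c
    have h3 : ‖(p : E × E).2‖ ≤ ‖(p : E × E).2 + (I * c : ℂ) • (p : E × E).1‖ := by
      refine abs_le_of_sq_le_sq' ?_ (norm_nonneg _) |>.2
      rw [h2]
      have : 0 ≤ c ^ 2 * ‖(p : E × E).1‖ ^ 2 := by positivity
      linarith
    have h4 : 0 ≤ |c|⁻¹ * ‖(p : E × E).2 + (I * c : ℂ) • (p : E × E).1‖ := by positivity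
    rw [Submodule.coe_norm, Prod.norm_def, add_mul, one_mul]
    have h5 := norm_nonneg ((p : E × E).2 + (I * c : ℂ) • (p : E × E).1)
    exact max_le (h1.trans (by linarith)) (by linarith)
  have hrc : IsClosed (Set.range L) := hanti.isClosed_range L.uniformContinuous
  have hrange : LinearMap.range (L : G →ₗ[ℂ] E) = ⊤ := by
    have : CompleteSpace (LinearMap.range (L : G →ₗ[ℂ] E)) :=
      completeSpace_coe_iff_isComplete.2 hrc.isComplete
    rw [← Submodule.orthogonal_eq_bot_iff, Submodule.eq_bot_iff]
    intro f hf
    -- A vector orthogonal to the range is an eigenvector with the non-real eigenvalue `i c`, which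
    -- symmetry forbids.
    have h1 : (f, (I * c : ℂ) • f) ∈ G := by
      refine mem_of_adjoint_eq hG fun x z hxz => ?_
      have h2 : ⟪z + (I * c : ℂ) • x, f⟫_ℂ = 0 := hf _ ⟨⟨(x, z), hxz⟩, rfl⟩
      rw [inner_add_left, inner_smul_left] at h2
      rw [inner_smul_right]
      simp only [map_mul, conj_I, conj_ofReal] at h2
      linear_combination h2
    have h2 := inner_symm_of_adjoint_eq hG h1 h1
    rw [inner_smul_left, inner_smul_right] at h2
    simp only [map_mul, conj_I, conj_ofReal] at h2
    have h3 : (2 * I * c : ℂ) * ⟪f, f⟫_ℂ = 0 := by linear_combination -h2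
    have h4 : (2 * I * c : ℂ) ≠ 0 := by simp [hc]
    exact inner_self_eq_zero.1 ((mul_eq_zero.1 h3).resolve_left h4)
  obtain ⟨p, hp⟩ : y ∈ LinearMap.range (L : G →ₗ[ℂ] E) := hrange ▸ Submodule.mem_top
  refine ⟨(p : E × E).1, ?_⟩
  have : y - (I * c : ℂ) • (p : E × E).1 = (p : E × E).2 := by
    rw [← hp]
    simp [hL]
  rw [this]
  exact p.2

/-- `R` is the resolvent `(G + i c)⁻¹`. -/
def IsResolvent (G : Submodule ℂ (E × E)) (c : ℝ) (R : E →L[ℂ] E) : Prop :=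
  ∀ y, (R y, y - (I * c : ℂ) • R y) ∈ G

/-- Uniqueness of the solution of `(G + i c) x = y`. It makes the pointwise choice of solutions
linear, and it evaluates resolvents by exhibiting a member of `G`. -/
lemma eq_of_resolvent_mem (hG : G.adjoint = G) {c : ℝ} (hc : c ≠ 0) {x x' y : E}
    (h : (x, y - (I * c : ℂ) • x) ∈ G) (h' : (x', y - (I * c : ℂ) • x') ∈ G) : x = x' := by
  have h1 := norm_le_of_mem hG (G.sub_mem h h') hc
  have h2 : y - (I * c : ℂ) • x - (y - (I * c : ℂ) • x') + (I * c : ℂ) • (x - x') = 0 := by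
    module
  rw [h2, norm_zero, mul_zero] at h1
  exact sub_eq_zero.1 (norm_le_zero_iff.1 h1)

lemma exists_isResolvent [CompleteSpace E] (hG : G.adjoint = G) {c : ℝ} (hc : c ≠ 0) :
    ∃ R : E →L[ℂ] E, IsResolvent G c R := by
  choose r hr using exists_resolvent_apply hG hc
  let R₀ : E →ₗ[ℂ] E :=
    { toFun := r
      map_add' := fun y y' => by
        refine eq_of_resolvent_mem hG hc (hr _) ?_
        have := G.add_mem (hr y) (hr y')
        rw [Prod.mk_add_mk] at this
        convert! this using 2
        module
      map_smul' := fun a y => by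
        refine eq_of_resolvent_mem hG hc (hr _) ?_
        have := G.smul_mem a (hr y)
        rw [Prod.smul_mk] at this
        convert! this using 2
        simp only [RingHom.id_apply]
        module }
  refine ⟨R₀.mkContinuous |c|⁻¹ fun y => ?_, hr⟩
  have h := norm_le_of_mem hG (hr y) hc
  rwa [sub_add_cancel] at h

namespace IsResolvent

variable {c d : ℝ} {R S : E →L[ℂ] E}

lemma norm_le (hR : IsResolvent G c R) (hG : G.adjoint = G) (hc : c ≠ 0) (y : E) :
    ‖R y‖ ≤ |c|⁻¹ * ‖y‖ := by
  have h := norm_le_of_mem hG (hR y) hc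
  rwa [sub_add_cancel] at h

lemma eq_apply (hR : IsResolvent G c R) (hG : G.adjoint = G) (hc : c ≠ 0) {x y : E}
    (h : (x, y - (I * c : ℂ) • x) ∈ G) : x = R y :=
  eq_of_resolvent_mem hG hc h (hR y)

lemma apply_snd (hR : IsResolvent G c R) (hG : G.adjoint = G) (hc : c ≠ 0) {f g : E}
    (h : (f, g) ∈ G) : R g = f - (I * c : ℂ) • R f := by
  refine (hR.eq_apply hG hc ?_).symm
  have := G.sub_mem h (G.smul_mem (I * c : ℂ) (hR f))
  rwa [Prod.smul_mk, Prod.mk_sub_mk] at this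

/-- By `apply_snd` for the pair through `S y`, the vector `R (S y)` solves the equation whose only
solution is `S (R y)`. -/
lemma commute (hR : IsResolvent G c R) (hS : IsResolvent G d S) (hG : G.adjoint = G)
    (hc : c ≠ 0) (hd : d ≠ 0) : Commute R S := by
  ext y
  refine hS.eq_apply (y := R y) hG hd ?_
  have h := hR (S y)
  have h2 := hR.apply_snd hG hc (hS y)
  rw [map_sub, map_smul] at h2
  have h3 : S y - (I * c : ℂ) • R (S y) = R y - (I * d : ℂ) • R (S y) := h2.symm
  rw [h3] at h
  exact h

lemma inner_apply (hR : IsResolvent G c R) (hS : IsResolvent G (-c) S) (hG : G.adjoint = G)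
    (y w : E) : ⟪R y, w⟫_ℂ = ⟪y, S w⟫_ℂ := by
  have h := inner_symm_of_adjoint_eq hG (hR y) (hS w)
  rw [inner_sub_left, inner_sub_right, inner_smul_left, inner_smul_right] at h
  simp only [map_mul, conj_I, conj_ofReal, ofReal_neg] at h
  linear_combination -h

end IsResolvent

end Resolvent

/-! ### Unitary groups of bounded self-adjoint operators -/

section Bounded

variable [CompleteSpace E]

/-- The unitary group `t ↦ e^{ita}` of a bounded operator. -/
def expI (a : E →L[ℂ] E) (t : ℝ) : E →L[ℂ] E := NormedSpace.exp ((t : ℂ) • (I • a))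

lemma expI_zero (a : E →L[ℂ] E) : expI a 0 = 1 := by simp [expI]

lemma expI_add (a : E →L[ℂ] E) (s t : ℝ) : expI a (s + t) = expI a s * expI a t := by
  let +nondep : NormedAlgebra ℚ (E →L[ℂ] E) := .restrictScalars ℚ ℂ _
  rw [expI, ofReal_add, add_smul, NormedSpace.exp_add_of_commute]
  · rfl
  · exact ((Commute.refl (I • a)).smul_left _).smul_right _

lemma norm_expI_apply {a : E →L[ℂ] E} (ha : IsSelfAdjoint a) (t : ℝ) (f : E) :
    ‖expI a t f‖ = ‖f‖ := by
  have h : expI a t ∈ unitary (E →L[ℂ] E) := by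
    have h1 : IsSelfAdjoint ((t : ℂ) • a) := by
      rw [isSelfAdjoint_iff, star_smul, ha.star_eq, Complex.star_def, conj_ofReal]
    have h2 : NormedSpace.exp (I • ((t : ℂ) • a)) ∈ unitary (E →L[ℂ] E) :=
      (selfAdjoint.expUnitary ⟨(t : ℂ) • a, h1⟩).2
    rwa [expI, smul_comm]
  exact Unitary.norm_map ⟨_, h⟩ f

lemma hasDerivAt_expI_apply (a : E →L[ℂ] E) (t : ℝ) (f : E) :
    HasDerivAt (fun s : ℝ => expI a s f) (expI a t (I • a f)) t := by
  have h := (hasDerivAt_exp_smul_const (𝕂 := ℂ) (I • a) (t : ℂ)).scomp_of_eq t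
    (Complex.ofRealCLM.hasDerivAt (x := t)) rfl
  have h2 := ((ContinuousLinearMap.apply ℂ E f).restrictScalars ℝ).hasFDerivAt.comp_hasDerivAt t h
  have h3 : HasDerivAt (fun s : ℝ => expI a s f)
      ((1 : ℂ) • (NormedSpace.exp ((t : ℂ) • I • a) * I • a) f) t := h2
  rwa [one_smul] at h3

lemma continuous_expI_apply (a : E →L[ℂ] E) (f : E) : Continuous fun s : ℝ => expI a s f :=
  continuous_iff_continuousAt.2 fun t => (hasDerivAt_expI_apply a t f).continuousAt

/-- Mean value inequality: the derivative of the orbit has constant norm `‖a f‖`. -/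
lemma norm_expI_sub_self_le {a : E →L[ℂ] E} (ha : IsSelfAdjoint a) (t : ℝ) (f : E) :
    ‖expI a t f - f‖ ≤ |t| * ‖a f‖ := by
  have h := convex_univ.norm_image_sub_le_of_norm_hasDerivWithin_le (C := ‖a f‖) (x := (0 : ℝ))
    (y := t) (f := fun s : ℝ => expI a s f) (f' := fun s => expI a s (I • a f))
    (fun x _ => (hasDerivAt_expI_apply a x f).hasDerivWithinAt)
    (fun x _ => by rw [norm_expI_apply ha, norm_smul, norm_I, one_mul]) trivial trivial
  simpa [expI_zero, mul_comm] using h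

lemma expI_eq_mul_of_commute {a b : E →L[ℂ] E} (h : Commute a b) (t : ℝ) :
    expI a t = expI b t * expI (a - b) t := by
  let +nondep : NormedAlgebra ℚ (E →L[ℂ] E) := .restrictScalars ℚ ℂ _
  have : (t : ℂ) • (I • a) = (t : ℂ) • (I • b) + (t : ℂ) • (I • (a - b)) := by module
  rw [expI, this, NormedSpace.exp_add_of_commute]
  · rfl
  · have hb : Commute b (a - b) := (h.symm).sub_right (Commute.refl b)
    exact (((hb.smul_left I).smul_right I).smul_left _).smul_right _

/-- Commutation allows factoring out the isometry `expI b t`. The bound involves only `a f - b f`,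
so strong convergence of unbounded approximants on the domain is enough for the groups to converge.
-/
lemma norm_expI_sub_expI_le {a b : E →L[ℂ] E} (ha : IsSelfAdjoint a) (hb : IsSelfAdjoint b)
    (h : Commute a b) (t : ℝ) (f : E) : ‖expI a t f - expI b t f‖ ≤ |t| * ‖a f - b f‖ := by
  have h1 : expI a t f - expI b t f = expI b t (expI (a - b) t f - f) := by
    rw [expI_eq_mul_of_commute h, map_sub]; rfl
  rw [h1, norm_expI_apply hb]
  exact norm_expI_sub_self_le (ha.sub hb) t f

end Bounded

end Stone

section StoneTheorem

variable {E : Type*} [NormedAddCommGroup E] [InnerProductSpace ℂ E]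

/-! ### The Yosida approximation -/

lemma tendsto_apply_of_dense {F : Type*} [NormedAddCommGroup F] [NormedSpace ℂ F] {s : Set E}
    (hs : Dense s) {ι : Type*} {l : Filter ι} {T : ι → E →L[ℂ] F} {L : E →L[ℂ] F} {C : ℝ}
    (hT : ∀ k x, ‖T k x‖ ≤ C * ‖x‖) (h : ∀ x ∈ s, Tendsto (fun k => T k x) l (𝓝 (L x)))
    (x : E) : Tendsto (fun k => T k x) l (𝓝 (L x)) := by
  rw [Metric.tendsto_nhds]
  intro ε hε
  set M : ℝ := |C| + ‖L‖ + 1 with hM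
  have hM0 : 0 < M := by positivity
  obtain ⟨y, hy, hxy⟩ := Metric.mem_closure_iff.1 (hs x) (ε / (2 * M)) (by positivity)
  filter_upwards [Metric.tendsto_nhds.1 (h y hy) (ε / 2) (by positivity)] with k hk
  rw [dist_eq_norm] at hxy hk ⊢
  have e : T k x - L x = T k (x - y) - L (x - y) + (T k y - L y) := by
    simp only [map_sub]; abel
  have h1 : ‖T k (x - y)‖ ≤ |C| * ‖x - y‖ :=
    (hT k _).trans (mul_le_mul_of_nonneg_right (le_abs_self C) (norm_nonneg _))
  have h2 := L.le_opNorm (x - y)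
  have h3 : M * ‖x - y‖ < ε / 2 := by
    rw [lt_div_iff₀ (by positivity)] at hxy
    linarith
  calc ‖T k x - L x‖ ≤ ‖T k (x - y)‖ + ‖L (x - y)‖ + ‖T k y - L y‖ := by
        rw [e]; exact (norm_add_le _ _).trans (add_le_add_left (norm_sub_le _ _) _)
    _ < ε := by nlinarith [norm_nonneg (x - y)]

variable {G : Submodule ℂ (E × E)}

/-- If `g` is orthogonal to all first components, then `(0, g)` lies in the adjoint, which is `G`;
`h0` says that `G` is single-valued. -/
lemma dense_fst_of_adjoint_eq [CompleteSpace E] (hG : G.adjoint = G)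
    (h0 : ∀ g, ((0 : E), g) ∈ G → g = 0) : Dense {f : E | ∃ g, (f, g) ∈ G} := by
  have h : {f : E | ∃ g, (f, g) ∈ G} = (G.map (LinearMap.fst ℂ E E) : Set E) := by
    ext f
    simp
  rw [h, Submodule.dense_iff_topologicalClosure_eq_top, Submodule.topologicalClosure_eq_top_iff,
    Submodule.eq_bot_iff]
  refine fun g hg => h0 g (mem_of_adjoint_eq hG fun x z hxz => ?_)
  rw [inner_zero_right, hg x ⟨(x, z), hxz, rfl⟩]

/-- On the domain, `i c R x = x - R g` with `‖R g‖ ≤ |c|⁻¹ ‖g‖`; the operators `i c R` are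
contractions, so density gives the rest. -/
lemma tendsto_smul_resolvent [CompleteSpace E] (hG : G.adjoint = G)
    (h0 : ∀ g, ((0 : E), g) ∈ G → g = 0)
    {c : ℕ → ℝ} (hc : ∀ k, c k ≠ 0) (hlim : Tendsto (fun k => |c k|⁻¹) atTop (𝓝 0))
    {R : ℕ → E →L[ℂ] E} (hR : ∀ k, IsResolvent G (c k) (R k)) (f : E) :
    Tendsto (fun k => (I * c k : ℂ) • R k f) atTop (𝓝 f) := by
  refine tendsto_apply_of_dense (dense_fst_of_adjoint_eq hG h0) (C := 1)
    (T := fun k => (I * c k : ℂ) • R k) (L := ContinuousLinearMap.id ℂ E) ?_ ?_ f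
  · intro k x
    rw [smul_apply, norm_smul, one_mul]
    simp only [Complex.norm_mul, norm_I, one_mul, norm_real, Real.norm_eq_abs]
    have h1 := (hR k).norm_le hG (hc k) x
    have h2 : 0 < |c k| := abs_pos.2 (hc k)
    rwa [inv_mul_eq_div, le_div_iff₀ h2, mul_comm] at h1
  · rintro x ⟨g, hg⟩
    have h1 : ∀ k, ((I * c k : ℂ) • R k) x = x - R k g := fun k => by
      rw [(hR k).apply_snd hG (hc k) hg, smul_apply]; abel
    simp only [h1, ContinuousLinearMap.id_apply]
    have h2 : Tendsto (fun k => R k g) atTop (𝓝 0) :=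
      squeeze_zero_norm (fun k => (hR k).norm_le hG (hc k) g)
        (by simpa using hlim.mul_const ‖g‖)
    simpa using tendsto_const_nhds.sub h2

/-- A self-adjoint operator is approximated on its domain by commuting bounded self-adjoint
operators. -/
lemma exists_yosida [CompleteSpace E] (hG : G.adjoint = G)
    (h0 : ∀ g, ((0 : E), g) ∈ G → g = 0) :
    ∃ a : ℕ → E →L[ℂ] E, (∀ k, IsSelfAdjoint (a k)) ∧ (∀ j k, Commute (a j) (a k)) ∧
      ∀ f g, (f, g) ∈ G → Tendsto (fun k => a k f) atTop (𝓝 g) := by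
  have hpos : ∀ k : ℕ, ((k : ℝ) + 1) ≠ 0 := fun k => by positivity
  have hneg : ∀ k : ℕ, -((k : ℝ) + 1) ≠ 0 := fun k => neg_ne_zero.2 (hpos k)
  choose R hR using fun k : ℕ => exists_isResolvent hG (hpos k)
  choose S hS using fun k : ℕ => exists_isResolvent hG (hneg k)
  have hlim : Tendsto (fun k : ℕ => |(k : ℝ) + 1|⁻¹) atTop (𝓝 0) := by
    have := tendsto_one_div_add_atTop_nhds_zero_nat (𝕜 := ℝ)
    refine this.congr fun k => ?_
    rw [abs_of_pos (by positivity), one_div]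
  have hlim' : Tendsto (fun k : ℕ => |-((k : ℝ) + 1)|⁻¹) atTop (𝓝 0) := by
    simpa only [abs_neg] using hlim
  -- With `c = k + 1`, never zero, this is formally `c² A (A² + c²)⁻¹`. Pairing the resolvents at
  -- `c` and `-c`, adjoint to each other, makes it self-adjoint.
  refine ⟨fun k => ((((k : ℝ) + 1) ^ 2 / 2 : ℝ) : ℂ) • (R k + S k), fun k => ?_, fun j k => ?_,
    fun f g hfg => ?_⟩
  · have hadj : star (R k) = S k := by
      rw [ContinuousLinearMap.star_eq_adjoint]
      refine (ContinuousLinearMap.eq_adjoint_iff _ _).2 ?_ |>.symm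
      intro x y
      have h := (hR k).inner_apply (hS k) hG y x
      rw [← inner_conj_symm, ← h, inner_conj_symm]
    have hadj' : star (S k) = R k := by rw [← hadj, star_star]
    rw [isSelfAdjoint_iff, star_smul, star_add, hadj, hadj', add_comm (S k), Complex.star_def,
      conj_ofReal]
  · have h1 := (hR j).commute (hR k) hG (hpos j) (hpos k)
    have h2 := (hR j).commute (hS k) hG (hpos j) (hneg k)
    have h3 := (hS j).commute (hR k) hG (hneg j) (hpos k)
    have h4 := (hS j).commute (hS k) hG (hneg j) (hneg k)
    exact (((h1.add_right h2).add_left (h3.add_right h4)).smul_left _).smul_right _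
  -- On the graph the approximant sends `f` to `(1/2)(i c R g - i c S g)`, and both `i c R g` and
  -- `-i c S g` tend to `g`.
  · have hr := tendsto_smul_resolvent hG h0 hpos hlim hR g
    have hs := tendsto_smul_resolvent hG h0 hneg hlim' hS g
    have h := (hr.add hs).const_smul (1 / 2 : ℂ)
    have e : (1 / 2 : ℂ) • (g + g) = g := by module
    rw [e] at h
    refine h.congr fun k => ?_
    rw [(hR k).apply_snd hG (hpos k) hfg, (hS k).apply_snd hG (hneg k) hfg,
      smul_apply, add_apply]
    simp only [smul_add, smul_sub, smul_smul]
    push_cast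
    have hI : I * I = -1 := I_mul_I
    match_scalars <;> first | ring1 | linear_combination (-(1/2) * ((k : ℂ) + 1) ^ 2) * hI

/-! ### The unitary group -/

lemma cauchySeq_of_dense_of_isometry {s : Set E} (hs : Dense s) {T : ℕ → E →L[ℂ] E}
    (hT : ∀ k x, ‖T k x‖ = ‖x‖) (h : ∀ x ∈ s, CauchySeq fun k => T k x) (x : E) :
    CauchySeq fun k => T k x := by
  rw [Metric.cauchySeq_iff]
  intro ε hε
  obtain ⟨y, hy, hxy⟩ := Metric.mem_closure_iff.1 (hs x) (ε / 3) (by positivity)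
  obtain ⟨N, hN⟩ := Metric.cauchySeq_iff.1 (h y hy) (ε / 3) (by positivity)
  have key : ∀ k, dist (T k x) (T k y) = dist x y := fun k => by
    rw [dist_eq_norm, dist_eq_norm, ← map_sub, hT]
  refine ⟨N, fun m hm n hn => ?_⟩
  have h1 := dist_triangle4 (T m x) (T m y) (T n y) (T n x)
  have h2 := hN m hm n hn
  rw [key, dist_comm (T n y), key] at h1
  linarith

lemma tendsto_norm_self_mul {a : ℕ → E →L[ℂ] E} {f g : E}
    (h : Tendsto (fun k => a k f) atTop (𝓝 g)) (t : ℝ) :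
    Tendsto (fun k => |t| * ‖a k f‖) atTop (𝓝 (|t| * ‖g‖)) :=
  h.norm.const_mul _

/-- **Stone's theorem**, existence of the unitary group of a self-adjoint operator. -/
theorem exists_isUnitaryGroupOf [CompleteSpace E] {A : E →ₗ.[ℂ] E}
    (hA : A.graph.adjoint = A.graph) : ∃ U : ℝ → E →L[ℂ] E, IsUnitaryGroupOf U A := by
  have h0 : ∀ g, ((0 : E), g) ∈ A.graph → g = 0 := fun g hg =>
    LinearPMap.graph_fst_eq_zero_snd A hg rfl
  have hdense := dense_fst_of_adjoint_eq hA h0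
  obtain ⟨a, hsa, hcomm, hlim⟩ := exists_yosida hA h0
  have hcauchy : ∀ (t : ℝ) (f : E), CauchySeq fun k => expI (a k) t f := by
    intro t
    refine cauchySeq_of_dense_of_isometry hdense (fun k x => norm_expI_apply (hsa k) t x) ?_
    rintro f ⟨g, hfg⟩
    rw [Metric.cauchySeq_iff]
    intro ε hε
    obtain ⟨N, hN⟩ := Metric.cauchySeq_iff.1 (hlim f g hfg).cauchySeq (ε / (|t| + 1))
      (by positivity)
    refine ⟨N, fun m hm n hn => ?_⟩
    have h1 := norm_expI_sub_expI_le (hsa m) (hsa n) (hcomm m n) t f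
    have h2 := hN m hm n hn
    rw [dist_eq_norm] at h2 ⊢
    rw [lt_div_iff₀ (by positivity)] at h2
    nlinarith [norm_nonneg (a m f - a n f)]
  choose u hu using fun t f => cauchySeq_tendsto_of_complete (hcauchy t f)
  have hnorm : ∀ t f, ‖u t f‖ = ‖f‖ := fun t f =>
    tendsto_nhds_unique (hu t f).norm (by simp [norm_expI_apply (hsa _)])
  let U : ℝ → E →L[ℂ] E := fun t => LinearMap.mkContinuous
    { toFun := u t
      map_add' := fun f g => tendsto_nhds_unique (hu t (f + g))
        (by simpa using (hu t f).add (hu t g))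
      map_smul' := fun c f => tendsto_nhds_unique (hu t (c • f))
        (by simpa using (hu t f).const_smul c) } 1 fun f => by
          rw [one_mul]; exact (hnorm t f).le
  have hU : ∀ t f, Tendsto (fun k => expI (a k) t f) atTop (𝓝 (U t f)) := hu
  have hUn : ∀ t f, ‖U t f‖ = ‖f‖ := hnorm
  have hzero : U 0 = 1 := by
    ext f
    exact tendsto_nhds_unique (hU 0 f) (by simp [expI_zero])
  have hadd : ∀ s t, U (s + t) = U s * U t := by
    intro s t
    ext f
    refine tendsto_nhds_unique (hU (s + t) f) ?_
    have h1 : Tendsto (fun k => expI (a k) s (expI (a k) t f - U t f)) atTop (𝓝 0) := by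
      rw [tendsto_zero_iff_norm_tendsto_zero]
      simp only [norm_expI_apply (hsa _)]
      simpa using ((hU t f).sub_const (U t f)).norm
    have h2 := h1.add (hU s (U t f))
    simp only [zero_add, map_sub, sub_add_cancel] at h2
    refine h2.congr fun k => ?_
    rw [expI_add]; rfl
  have hcont0 : ∀ f, Tendsto (fun t => U t f) (𝓝 0) (𝓝 f) := by
    refine tendsto_apply_of_dense hdense (C := 1) (L := ContinuousLinearMap.id ℂ E)
      (fun t x => by rw [hUn, one_mul]) ?_
    rintro f ⟨g, hfg⟩
    have h1 : ∀ t, ‖U t f - f‖ ≤ |t| * ‖g‖ := fun t =>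
      le_of_tendsto_of_tendsto' ((hU t f).sub_const f).norm (tendsto_norm_self_mul (hlim f g hfg) t)
        fun k => norm_expI_sub_self_le (hsa k) t f
    rw [tendsto_iff_norm_sub_tendsto_zero]
    refine squeeze_zero (fun _ => norm_nonneg _) h1 ?_
    have : Continuous fun t : ℝ => |t| * ‖g‖ := by fun_prop
    simpa using this.tendsto 0
  have hcont : ∀ f, Continuous fun t => U t f := by
    intro f
    rw [continuous_iff_continuousAt]
    intro t
    rw [ContinuousAt, tendsto_iff_norm_sub_tendsto_zero]
    have h1 : ∀ s, ‖U s f - U t f‖ = ‖U (s - t) f - f‖ := fun s => by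
      have : U s f = U t (U (s - t) f) := by
        rw [← mul_apply_eq_comp, ← hadd, add_sub_cancel]
      rw [this, ← map_sub, hUn]
    simp only [h1]
    have h2 : Tendsto (fun s : ℝ => s - t) (𝓝 t) (𝓝 0) := by
      simpa using (continuous_sub_right t).tendsto t
    simpa using (((hcont0 f).comp h2).sub_const f).norm
  have hderiv : ∀ f g, (f, g) ∈ A.graph → HasDerivAt (fun t => U t f) (I • g) 0 := by
    intro f g hfg
    -- Derivatives need not survive a pointwise limit, so the limit is taken in the integrated
    -- equation, dominated because `a k f` converges and is therefore bounded.
    have hint : ∀ t : ℝ, U t f = f + ∫ s in (0 : ℝ)..t, U s (I • g) := by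
      intro t
      have h1 : ∀ k, expI (a k) t f = f + ∫ s in (0 : ℝ)..t, expI (a k) s (I • a k f) := by
        intro k
        rw [intervalIntegral.integral_eq_sub_of_hasDerivAt
          (fun s _ => hasDerivAt_expI_apply (a k) s f)
          ((continuous_expI_apply (a k) (I • a k f)).intervalIntegrable 0 t), expI_zero]
        simp
      obtain ⟨C, hC⟩ := (hlim f g hfg).norm.bddAbove_range
      have h2 : Tendsto (fun k => ∫ s in (0 : ℝ)..t, expI (a k) s (I • a k f)) atTop
          (𝓝 (∫ s in (0 : ℝ)..t, U s (I • g))) := by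
        refine intervalIntegral.tendsto_integral_filter_of_dominated_convergence (fun _ => C)
          (Eventually.of_forall fun k => (continuous_expI_apply (a k) _).aestronglyMeasurable)
          (Eventually.of_forall fun k => Eventually.of_forall fun s _ => ?_)
          intervalIntegrable_const (Eventually.of_forall fun s _ => ?_)
        · rw [norm_expI_apply (hsa k), norm_smul, norm_I, one_mul]
          exact hC ⟨k, rfl⟩
        · have h3 : Tendsto (fun k => expI (a k) s (I • (a k f - g))) atTop (𝓝 0) := by
            rw [tendsto_zero_iff_norm_tendsto_zero]
            simp only [norm_expI_apply (hsa _), norm_smul, norm_I, one_mul]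
            simpa using ((hlim f g hfg).sub_const g).norm
          have h4 := h3.add (hU s (I • g))
          simpa only [zero_add, smul_sub, map_sub, sub_add_cancel] using h4
      exact tendsto_nhds_unique (hU t f) ((h2.const_add f).congr fun k => (h1 k).symm)
    have h1 := (intervalIntegral.integral_hasDerivAt_right
      ((hcont (I • g)).intervalIntegrable 0 0)
      (hcont (I • g)).stronglyMeasurable.stronglyMeasurableAtFilter
      (hcont (I • g)).continuousAt).const_add f
    rw [hzero] at h1
    exact h1.congr_of_eventuallyEq (Eventually.of_forall hint)
  have hinner : ∀ t f g, ⟪U t f, U t g⟫_ℂ = ⟪f, g⟫_ℂ := fun t f g =>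
    (LinearMap.norm_map_iff_inner_map_map (U t)).1 (hUn t) f g
  refine ⟨U, hzero, hadd, fun t => ?_, hcont, fun f => ⟨fun hf => ?_, fun hf => ?_⟩, fun f => ?_⟩
  · have h1 : star (U t) * U t = 1 := by
      ext f
      refine ext_inner_right ℂ fun g => ?_
      rw [ContinuousLinearMap.star_eq_adjoint, mul_apply_eq_comp,
        ContinuousLinearMap.adjoint_inner_left, hinner]
      rfl
    have h2 : U t * U (-t) = 1 := by rw [← hadd, add_neg_cancel, hzero]
    refine ⟨h1, ?_⟩
    have h3 : star (U t) = U (-t) := by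
      rw [← mul_one (star (U t)), ← h2, ← mul_assoc, h1, one_mul]
    rw [h3, h2]
  · exact (hderiv f (A ⟨f, hf⟩) (A.mem_graph ⟨f, hf⟩)).differentiableAt
  · set d := deriv (fun t => U t f) 0 with hd
    have h1 : HasDerivAt (fun t => U t f) d 0 := hf.hasDerivAt
    -- The domain is no smaller than the set of differentiable vectors: differentiating the constant
    -- `⟪U t x, U t f⟫` at `0` shows that `(f, -i d)` is in the adjoint graph.
    have h2 : (f, -I • d) ∈ A.graph := by
      refine mem_of_adjoint_eq hA fun x z hxz => ?_
      have h3 := (hderiv x z hxz).inner ℂ h1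
      simp only [hinner] at h3
      have h4 := h3.unique (hasDerivAt_const _ _)
      rw [hzero, inner_smul_left] at h4
      rw [inner_smul_right]
      simp only [conj_I, one_apply_eq_self] at h4
      linear_combination I * h4 + ⟪z, f⟫_ℂ * I_mul_I
    exact LinearPMap.mem_domain_of_mem_graph h2
  · exact hderiv f (A f) (A.mem_graph f)

end StoneTheorem

section Evolution

variable {E : Type*} [NormedAddCommGroup E] [InnerProductSpace ℂ E] [CompleteSpace E]

/-! ## Differentiability of the Heisenberg evolution -/

namespace IsUnitaryGroupOf

variable {U : ℝ → E →L[ℂ] E} {A : E →ₗ.[ℂ] E}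

lemma norm_apply (hU : IsUnitaryGroupOf U A) (t : ℝ) (f : E) : ‖U t f‖ = ‖f‖ :=
  Unitary.norm_map ⟨_, hU.unitary t⟩ f

lemma apply_add (hU : IsUnitaryGroupOf U A) (s t : ℝ) (f : E) : U (s + t) f = U s (U t f) := by
  rw [hU.add]; rfl

lemma hasDerivAt_of_mem (hU : IsUnitaryGroupOf U A) {f g : E} (h : (f, g) ∈ A.graph) :
    HasDerivAt (fun t => U t f) (I • g) 0 := by
  obtain ⟨y, rfl, rfl⟩ := (LinearPMap.mem_graph_iff A).1 h
  exact hU.hasDerivAt y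

lemma mem_graph_of_hasDerivAt (hU : IsUnitaryGroupOf U A) {f g : E}
    (h : HasDerivAt (fun t => U t f) (I • g) 0) : (f, g) ∈ A.graph := by
  have hf : f ∈ A.domain := (hU.mem_domain_iff f).2 h.differentiableAt
  have h1 := (hU.hasDerivAt ⟨f, hf⟩).unique h
  have h2 : A ⟨f, hf⟩ = g := smul_right_injective E I_ne_zero h1
  exact h2 ▸ A.mem_graph ⟨f, hf⟩

lemma apply_mem_graph (hU : IsUnitaryGroupOf U A) {f g : E} (h : (f, g) ∈ A.graph) (t : ℝ) :
    (U t f, U t g) ∈ A.graph := by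
  refine hU.mem_graph_of_hasDerivAt ?_
  have h1 := ((U t).restrictScalars ℝ).hasFDerivAt.comp_hasDerivAt 0 (hU.hasDerivAt_of_mem h)
  have h2 : HasDerivAt (fun s => U t (U s f)) (U t (I • g)) 0 := h1
  rw [map_smul] at h2
  refine h2.congr_of_eventuallyEq (Eventually.of_forall fun s => ?_)
  change U s (U t f) = U t (U s f)
  rw [← hU.apply_add, ← hU.apply_add, add_comm]

/-- A product rule although `U` is only strongly continuous: the remainder of `w` is controlled by
isometry, and `U t w' - w'` tends to zero. -/
lemma hasDerivAt_apply (hU : IsUnitaryGroupOf U A) {f g : E} (h : (f, g) ∈ A.graph)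
    {w : ℝ → E} {w' : E} (hw : HasDerivAt w w' 0) (hw0 : w 0 = f) :
    HasDerivAt (fun t => U t (w t)) (w' + I • g) 0 := by
  have h1 := hU.hasDerivAt_of_mem h
  have h2 : Tendsto (fun t => U t w' - w') (𝓝 0) (𝓝 0) := by
    have := ((hU.continuous w').tendsto 0).sub_const w'
    simpa [hU.zero] using this
  rw [hasDerivAt_iff_isLittleO] at hw h1 ⊢
  have h3 : (fun t : ℝ => (t - 0) • (U t w' - w')) =o[𝓝 0] fun t : ℝ => t - 0 := by
    simpa using (Asymptotics.isBigO_refl (fun t : ℝ => t - 0) (𝓝 0)).smul_isLittleO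
      ((Asymptotics.isLittleO_one_iff ℝ).2 h2)
  have h4 : (fun t : ℝ => U t (w t - w 0 - (t - 0) • w')) =o[𝓝 0] fun t : ℝ => t - 0 := by
    rw [← Asymptotics.isLittleO_norm_left] at hw ⊢
    simpa only [hU.norm_apply] using hw
  refine ((h4.add h3).add h1).congr_left fun t => ?_
  have h5 : U t ((t - 0) • w') = (t - 0) • U t w' := (U t).map_smul_of_tower _ _
  rw [map_sub, map_sub, h5, hw0, hU.zero]
  simp only [one_apply_eq_self]
  module

/-- If `[A, H]` extends to the bounded operator `K`, then `t ↦ e^{itA} H e^{-itA} f` is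
differentiable, first for `f` in the domain and then everywhere. -/
lemma hasDerivAt_conj (hU : IsUnitaryGroupOf U A) {H K : E →L[ℂ] E}
    (hHK : ∀ f g, (f, g) ∈ A.graph → (H f, H g + K f) ∈ A.graph)
    (hdense : Dense {f : E | ∃ g, (f, g) ∈ A.graph}) (f : E) (t : ℝ) :
    HasDerivAt (fun t => U t (H (U (-t) f))) (U t ((I • K) (U (-t) f))) t := by
  -- At time zero the inner factor contributes `-i H g` and the outer one `i (H g + K f)`; the
  -- unbounded terms cancel.
  have key0 : ∀ f g, (f, g) ∈ A.graph →
      HasDerivAt (fun t => U t (H (U (-t) f))) ((I • K) f) 0 := by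
    intro f g hfg
    have h1 : HasDerivAt (fun t => U (-t) f) (-(I • g)) 0 := by
      have h2 := hU.hasDerivAt_of_mem hfg
      have h3 := h2.scomp_of_eq (0 : ℝ) (hasDerivAt_neg (0 : ℝ)) neg_zero.symm
      rwa [neg_one_smul] at h3
    have h3 : HasDerivAt (fun t => H (U (-t) f)) (H (-(I • g))) 0 :=
      (H.restrictScalars ℝ).hasFDerivAt.comp_hasDerivAt 0 h1
    have h4 := hU.hasDerivAt_apply (hHK f g hfg) h3 (by simp [hU.zero])
    convert! h4 using 1
    rw [map_neg, map_smul, smul_apply]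
    module
  have key : ∀ f g, (f, g) ∈ A.graph → ∀ t,
      HasDerivAt (fun t => U t (H (U (-t) f))) (U t ((I • K) (U (-t) f))) t := by
    intro f g hfg t
    -- Other times reduce to zero by the group law, because `U` preserves the graph.
    have h1 := key0 _ _ (hU.apply_mem_graph hfg (-t))
    have h2 := h1.scomp_of_eq t ((hasDerivAt_id t).sub_const t) (sub_self t).symm
    rw [one_smul] at h2
    have h3 : HasDerivAt _ _ t := ((U t).restrictScalars ℝ).hasFDerivAt.comp_hasDerivAt t h2
    refine h3.congr_of_eventuallyEq (Eventually.of_forall fun s => ?_)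
    change U s (H (U (-s) f)) = U t (U (s - t) (H (U (-(s - t)) (U (-t) f))))
    rw [← hU.apply_add, ← hU.apply_add]
    congr 3 <;> ring_nf
  obtain ⟨F, hF, hFlim⟩ := mem_closure_iff_seq_limit.1 (hdense f)
  have hnorm : ∀ (L : E →L[ℂ] E) (n : ℕ) (s : ℝ),
      ‖U s (L (U (-s) f)) - U s (L (U (-s) (F n)))‖ ≤ ‖L‖ * ‖f - F n‖ := by
    intro L n s
    rw [← map_sub, ← map_sub, ← map_sub, hU.norm_apply]
    exact (L.le_opNorm _).trans_eq (by rw [hU.norm_apply])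
  have hlim0 : ∀ L : E →L[ℂ] E, Tendsto (fun n => ‖L‖ * ‖f - F n‖) atTop (𝓝 0) := fun L => by
    simpa using ((tendsto_const_nhds (x := f)).sub hFlim).norm.const_mul ‖L‖
  -- Since `U` is isometric and `H`, `K` are bounded, approximating `f` from the domain gives
  -- convergence of functions and derivatives uniformly in time.
  refine hasDerivAt_of_tendstoUniformly (f := fun n s => U s (H (U (-s) (F n))))
    (g := fun s => U s (H (U (-s) f))) (g' := fun s => U s ((I • K) (U (-s) f)))
    (f' := fun n s => U s ((I • K) (U (-s) (F n)))) (l := atTop) ?_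
    (Eventually.of_forall fun n s => key _ _ (hF n).choose_spec s) (fun s => ?_) t
  · rw [Metric.tendstoUniformly_iff]
    intro ε hε
    filter_upwards [(tendsto_order.1 (hlim0 (I • K))).2 ε hε] with n hn s
    rw [dist_eq_norm]
    exact (hnorm (I • K) n s).trans_lt hn
  · rw [tendsto_iff_norm_sub_tendsto_zero]
    refine squeeze_zero (fun _ => norm_nonneg _) (fun n => ?_) (hlim0 H)
    rw [norm_sub_rev]
    exact hnorm H n s

/-- If a space of bounded operators is stable under commutation with `A`, its elements are
smooth with respect to `A`. -/
lemma contDiff_conj (hU : IsUnitaryGroupOf U A) {T : Submodule ℂ (E →L[ℂ] E)}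
    (hT : ∀ H ∈ T, ∃ K ∈ T, ∀ f g, (f, g) ∈ A.graph → (H f, H g + K f) ∈ A.graph)
    (hdense : Dense {f : E | ∃ g, (f, g) ∈ A.graph}) (k : ℕ) :
    ∀ H ∈ T, ∀ f, ContDiff ℝ k fun t => U t (H (U (-t) f)) := by
  induction k with
  | zero =>
    intro H hH f
    obtain ⟨K, -, hHK⟩ := hT H hH
    exact contDiff_zero.2 (continuous_iff_continuousAt.2 fun t =>
      (hU.hasDerivAt_conj hHK hdense f t).continuousAt)
  -- The derivative has the same form, with `i K` in place of `H`, and `i K` is again in `T`.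
  | succ k ih =>
    intro H hH f
    obtain ⟨K, hK, hHK⟩ := hT H hH
    have h := hU.hasDerivAt_conj hHK hdense f
    rw [Nat.cast_succ, contDiff_succ_iff_deriv]
    refine ⟨fun t => (h t).differentiableAt, by simp, ?_⟩
    have hd : (deriv fun t => U t (H (U (-t) f))) = fun t => U t ((I • K) (U (-t) f)) :=
      funext fun t => (h t).deriv
    rw [hd]
    exact ih _ (T.smul_mem I hK) f

end IsUnitaryGroupOf

/-! ### Unitary equivalence -/

section Equivalence

variable {E F : Type*} [NormedAddCommGroup E] [InnerProductSpace ℂ E]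
  [NormedAddCommGroup F] [InnerProductSpace ℂ F]

/-- The operator `Φ H Φ⁻¹`. -/
def conjCLM (Φ : E ≃ₗᵢ[ℂ] F) (H : E →L[ℂ] E) : F →L[ℂ] F :=
  Φ.toContinuousLinearEquiv.toContinuousLinearMap ∘L H ∘L
    Φ.symm.toContinuousLinearEquiv.toContinuousLinearMap

lemma conjCLM_apply (Φ : E ≃ₗᵢ[ℂ] F) (H : E →L[ℂ] E) (f : F) :
    conjCLM Φ H f = Φ (H (Φ.symm f)) := rfl

variable [CompleteSpace E] [CompleteSpace F]

lemma IsUnitaryGroupOf.conj {U : ℝ → E →L[ℂ] E} {A : E →ₗ.[ℂ] E} (hU : IsUnitaryGroupOf U A)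
    (Φ : E ≃ₗᵢ[ℂ] F) {B : F →ₗ.[ℂ] F}
    (hAB : ∀ f g, (f, g) ∈ B.graph ↔ (Φ.symm f, Φ.symm g) ∈ A.graph) :
    IsUnitaryGroupOf (fun t => conjCLM Φ (U t)) B := by
  have hmul : ∀ H K : E →L[ℂ] E, conjCLM Φ (H * K) = conjCLM Φ H * conjCLM Φ K := fun H K => by
    ext f; simp [conjCLM_apply]
  have hone : conjCLM Φ (1 : E →L[ℂ] E) = 1 := by ext f; simp [conjCLM_apply]
  have hstar : ∀ H : E →L[ℂ] E, star (conjCLM Φ H) = conjCLM Φ (star H) := fun H => by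
    refine ((ContinuousLinearMap.eq_adjoint_iff _ _).2 fun x y => ?_).symm
    rw [conjCLM_apply, conjCLM_apply, ContinuousLinearMap.star_eq_adjoint,
      LinearIsometryEquiv.inner_map_eq_flip, ContinuousLinearMap.adjoint_inner_left]
    exact Φ.symm.inner_map_eq_flip x _
  have hderiv : ∀ f : F, ∀ d : E, HasDerivAt (fun t => U t (Φ.symm f)) d 0 →
      HasDerivAt (fun t => conjCLM Φ (U t) f) (Φ d) 0 := fun f d h =>
    ((Φ.toContinuousLinearEquiv.toContinuousLinearMap).restrictScalars ℝ).hasFDerivAt.comp_hasDerivAt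
      0 h
  refine ⟨?_, fun s t => ?_, fun t => ?_, fun f => ?_, fun f => ?_, fun f => ?_⟩
  · simp only [hU.zero, hone]
  · simp only [hU.add, hmul]
  · obtain ⟨h1, h2⟩ := hU.unitary t
    constructor
    · rw [hstar, ← hmul, h1, hone]
    · rw [hstar, ← hmul, h2, hone]
  · exact Φ.continuous.comp (hU.continuous _)
  · have hdom : f ∈ B.domain ↔ Φ.symm f ∈ A.domain := by
      rw [LinearPMap.mem_domain_iff, LinearPMap.mem_domain_iff]
      constructor
      · rintro ⟨g, hg⟩; exact ⟨_, (hAB f g).1 hg⟩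
      · rintro ⟨g, hg⟩; exact ⟨Φ g, (hAB f _).2 (by simpa using hg)⟩
    rw [hdom, hU.mem_domain_iff]
    constructor
    · exact fun h => (hderiv f _ h.hasDerivAt).differentiableAt
    · intro h
      have h1 := ((Φ.symm.toContinuousLinearEquiv.toContinuousLinearMap).restrictScalars
        ℝ).hasFDerivAt.comp_hasDerivAt 0 h.hasDerivAt
      refine (h1.congr_of_eventuallyEq (Eventually.of_forall fun t => ?_)).differentiableAt
      exact (Φ.symm_apply_apply _).symm
  · have h := hderiv f _ (hU.hasDerivAt_of_mem ((hAB f (B f)).1 (B.mem_graph f)))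
    rwa [map_smul, Φ.apply_symm_apply] at h

lemma IsOfClass.conj {k : ℕ} {H : E →L[ℂ] E} {A : E →ₗ.[ℂ] E} (h : IsOfClass k H A)
    (Φ : E ≃ₗᵢ[ℂ] F) {B : F →ₗ.[ℂ] F}
    (hAB : ∀ f g, (f, g) ∈ B.graph ↔ (Φ.symm f, Φ.symm g) ∈ A.graph) :
    IsOfClass k (conjCLM Φ H) B := by
  obtain ⟨U, hU, hd⟩ := h
  refine ⟨_, hU.conj Φ hAB, fun f => ?_⟩
  have h1 := ((Φ.toContinuousLinearEquiv.toContinuousLinearMap).restrictScalars ℝ).contDiff.comp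
    (hd (Φ.symm f))
  convert! h1 using 1
  ext t
  simp [conjCLM_apply]

end Equivalence

end Evolution

/-! ## The conjugate operator on the lattice -/

/-- The six neighbours of the origin. -/
def nbrs : Finset (ℤ × ℤ) := {(1, 0), (-1, 0), (0, 1), (0, -1), (-1, 1), (1, -1)}

lemma sum_nbrs {M : Type*} [AddCommMonoid M] (φ : ℤ × ℤ → M) :
    ∑ v ∈ nbrs, φ v = φ (1, 0) + (φ (-1, 0) + (φ (0, 1) + (φ (0, -1) + (φ (-1, 1) + φ (1, -1))))) := by
  simp [nbrs]

lemma sum_nbrs_neg {M : Type*} [AddCommMonoid M] (φ : ℤ × ℤ → M) :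
    ∑ v ∈ nbrs, φ (-v) = ∑ v ∈ nbrs, φ v := by
  simp only [sum_nbrs, Prod.neg_mk, neg_neg, neg_zero]
  abel

lemma neg_mem_nbrs {v : ℤ × ℤ} (hv : v ∈ nbrs) : -v ∈ nbrs := by
  simp only [nbrs, Finset.mem_insert, Finset.mem_singleton] at hv
  rcases hv with rfl | rfl | rfl | rfl | rfl | rfl <;> decide

/-- The weight `|n|² = n₁² + n₂²`. -/
def sqWeight (n : ℤ × ℤ) : ℝ := (n.1 : ℝ) ^ 2 + (n.2 : ℝ) ^ 2

lemma sqWeight_nonneg (n : ℤ × ℤ) : 0 ≤ sqWeight n := by unfold sqWeight; positivity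

/-- The conjugate operator is, up to a constant, the commutator of the Laplacian with `|n|²`. -/
lemma conjFun_apply (f : ℤ × ℤ → ℂ) (n : ℤ × ℤ) :
    conjFun f n = I / 12 * ∑ v ∈ nbrs, ((sqWeight (n + v) - sqWeight n : ℝ) : ℂ) * f (n + v) := by
  simp only [sum_nbrs, conjFun, LinearMap.coe_mk, AddHom.coe_mk, sqWeight, Prod.fst_add,
    Prod.snd_add]
  push_cast
  ring

/-- The graph of the conjugate operator on its maximal domain. -/
def maximalGraph : Submodule ℂ (L2Lattice × L2Lattice) where
  carrier := {p | ∀ n, p.2 n = conjFun p.1 n}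
  zero_mem' n := by
    change (0 : ℂ) = conjFun 0 n
    rw [map_zero]; rfl
  add_mem' {p q} hp hq n := by
    change p.2 n + q.2 n = conjFun ((p.1 : ℤ × ℤ → ℂ) + q.1) n
    rw [hp, hq, map_add]; rfl
  smul_mem' c p hp n := by
    change c * p.2 n = conjFun (c • (p.1 : ℤ × ℤ → ℂ)) n
    rw [hp, map_smul]; rfl

lemma mem_maximalGraph {f g : L2Lattice} :
    (f, g) ∈ maximalGraph ↔ ∀ n, g n = conjFun f n := Iff.rfl

lemma maximalGraph_unique {f g g' : L2Lattice} (h : (f, g) ∈ maximalGraph)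
    (h' : (f, g') ∈ maximalGraph) : g = g' := by
  ext n
  rw [mem_maximalGraph.1 h, mem_maximalGraph.1 h']

lemma continuous_coord (n : ℤ × ℤ) : Continuous fun f : L2Lattice => f n :=
  (continuous_apply n).comp (lp.uniformContinuous_coe (p := 2)).continuous

/-- Each defining equation involves finitely many coordinates, and coordinates are continuous on
`ℓ²`. -/
lemma isClosed_maximalGraph : IsClosed (maximalGraph : Set (L2Lattice × L2Lattice)) := by
  have h : (maximalGraph : Set (L2Lattice × L2Lattice)) =
      ⋂ n, {p | p.2 n = conjFun p.1 n} := by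
    ext p; simp [maximalGraph]
  rw [h]
  refine isClosed_iInter fun n => isClosed_eq ((continuous_coord n).comp continuous_snd) ?_
  simp only [conjFun_apply]
  have := fun m => (continuous_coord m).comp (continuous_fst (X := L2Lattice) (Y := L2Lattice))
  exact continuous_const.mul (continuous_finsetSum _ fun v _ => continuous_const.mul (this _))

/-- The point mass at `m`. -/
def delta (m : ℤ × ℤ) : L2Lattice := lp.single 2 m 1

lemma delta_apply (m n : ℤ × ℤ) : delta m n = if n = m then 1 else 0 := by
  rw [delta, lp.coeFn_single, Pi.single_apply]

lemma inner_delta (m : ℤ × ℤ) (f : L2Lattice) : ⟪delta m, f⟫_ℂ = f m := by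
  rw [delta, lp.inner_single_left]
  simp

/-- The image of the point mass at `m` under the conjugate operator. -/
def conjDelta (m : ℤ × ℤ) : L2Lattice :=
  (I / 12) • ∑ v ∈ nbrs, ((sqWeight m - sqWeight (m - v) : ℝ) : ℂ) • delta (m - v)

lemma lp_sum_apply {ι : Type*} (s : Finset ι) (f : ι → L2Lattice) (n : ℤ × ℤ) :
    (∑ i ∈ s, f i : L2Lattice) n = ∑ i ∈ s, f i n := by
  rw [lp.coeFn_sum, Finset.sum_apply]

lemma delta_mem (m : ℤ × ℤ) : (delta m, conjDelta m) ∈ maximalGraph := by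
  rw [mem_maximalGraph]
  intro n
  rw [conjFun_apply, conjDelta]
  change I / 12 * (∑ v ∈ nbrs, ((sqWeight m - sqWeight (m - v) : ℝ) : ℂ) • delta (m - v) :
    L2Lattice) n = _
  rw [lp_sum_apply]
  congr 1
  refine Finset.sum_congr rfl fun v _ => ?_
  change ((sqWeight m - sqWeight (m - v) : ℝ) : ℂ) * delta (m - v) n = _
  rw [delta_apply, delta_apply]
  by_cases h : n + v = m
  · rw [if_pos h, if_pos (eq_sub_of_add_eq h), h, eq_sub_of_add_eq h]
  · rw [if_neg h, if_neg fun h' => h (by rw [h', sub_add_cancel]), mul_zero, mul_zero]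

/-- Formal symmetry of the coefficients under `v ↦ -v`. It holds for every `f` in `ℓ²`, even when
`conjFun f` is not in `ℓ²`. -/
lemma inner_conjDelta (m : ℤ × ℤ) (f : L2Lattice) : ⟪conjDelta m, f⟫_ℂ = conjFun f m := by
  rw [conjFun_apply, ← sum_nbrs_neg, conjDelta, inner_smul_left, sum_inner, Finset.mul_sum,
    Finset.mul_sum]
  refine Finset.sum_congr rfl fun v _ => ?_
  rw [inner_smul_left, inner_delta, ← sub_eq_add_neg]
  simp only [map_div₀, conj_I, conj_ofReal, map_ofNat]
  push_cast
  ring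

/-! ### Finitely supported sequences are a core -/

/-- The cutoff `max 0 (1 - |n|² / k)`. -/
def cutoff (k : ℕ) (n : ℤ × ℤ) : ℝ := max 0 (1 - sqWeight n / (k + 1))

lemma cutoff_nonneg (k : ℕ) (n : ℤ × ℤ) : 0 ≤ cutoff k n := le_max_left _ _

lemma cutoff_le_one (k : ℕ) (n : ℤ × ℤ) : cutoff k n ≤ 1 := by
  have := sqWeight_nonneg n
  refine max_le zero_le_one ?_
  have : 0 ≤ sqWeight n / (k + 1) := by positivity
  linarith

lemma cutoff_eq_zero {k : ℕ} {n : ℤ × ℤ} (h : (k + 1 : ℝ) ≤ sqWeight n) : cutoff k n = 0 := by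
  refine max_eq_left ?_
  rw [sub_nonpos, le_div_iff₀ (by positivity)]
  linarith

lemma abs_cutoff_sub_le (k : ℕ) (m n : ℤ × ℤ) :
    |cutoff k m - cutoff k n| ≤ |sqWeight m - sqWeight n| / (k + 1) := by
  refine (abs_max_sub_max_le_max _ _ _ _).trans ?_
  rw [sub_self, abs_zero, max_eq_right (abs_nonneg _)]
  have h : 1 - sqWeight m / (k + 1) - (1 - sqWeight n / (k + 1)) =
      -((sqWeight m - sqWeight n) / (k + 1)) := by ring
  rw [h, abs_neg, abs_div, abs_of_pos (by positivity : (0 : ℝ) < k + 1)]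

lemma tendsto_cutoff (n : ℤ × ℤ) : Tendsto (fun k => cutoff k n) atTop (𝓝 1) := by
  have h := (tendsto_one_div_add_atTop_nhds_zero_nat (𝕜 := ℝ)).const_mul (sqWeight n)
  have h2 := (tendsto_const_nhds (x := (0 : ℝ))).max (h.const_sub 1)
  simp only [mul_zero, sub_zero, mul_one_div] at h2
  simpa [cutoff] using h2

/-- The diagonal neighbours dictate the constants: `4 (n₂ - n₁ + 1)² ≤ 8 (n₂ - n₁)² + 8 ≤ 16 |n|² +
8`, and likewise for the opposite one. -/
lemma sq_sqWeight_sub_le {v : ℤ × ℤ} (hv : v ∈ nbrs) (n : ℤ × ℤ) :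
    (sqWeight (n + v) - sqWeight n) ^ 2 ≤ 16 * sqWeight n + 8 := by
  simp only [nbrs, Finset.mem_insert, Finset.mem_singleton] at hv
  have h1 := sq_nonneg ((n.1 : ℝ) + 1)
  have h2 := sq_nonneg ((n.2 : ℝ) + 1)
  have h3 := sq_nonneg ((n.1 : ℝ) - 1)
  have h4 := sq_nonneg ((n.2 : ℝ) - 1)
  have h5 := sq_nonneg ((n.1 : ℝ) + n.2)
  have h6 := sq_nonneg ((n.1 : ℝ) - n.2 + 1)
  have h7 := sq_nonneg ((n.1 : ℝ) - n.2 - 1)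
  have h8 := sq_nonneg (n.1 : ℝ)
  have h9 := sq_nonneg (n.2 : ℝ)
  rcases hv with rfl | rfl | rfl | rfl | rfl | rfl <;>
    simp only [sqWeight, Prod.fst_add, Prod.snd_add] <;> push_cast <;> nlinarith

/-- The commutator of the cutoff with the conjugate operator has bounded coefficients. -/
lemma abs_mul_cutoff_sub_le {v : ℤ × ℤ} (hv : v ∈ nbrs) (k : ℕ) (n : ℤ × ℤ) :
    |(sqWeight (n + v) - sqWeight n) * (cutoff k (n + v) - cutoff k n)| ≤ 24 := by
  have hk : (0 : ℝ) < k + 1 := by positivity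
  -- The cutoff is Lipschitz in `|n|²` with constant `1/(k+1)`, so the product is at most `(16 w +
  -- 8)/(k+1) ≤ 24`. Here `w` is `|n|²` or `|n+v|²`, whichever is at most `k+1`; if neither is, both
  -- cutoffs vanish.
  have key : ∀ w, w ≤ (k + 1 : ℝ) → (sqWeight (n + v) - sqWeight n) ^ 2 ≤ 16 * w + 8 →
      |(sqWeight (n + v) - sqWeight n) * (cutoff k (n + v) - cutoff k n)| ≤ 24 := by
    intro w hw h
    rw [abs_mul]
    calc _ ≤ |sqWeight (n + v) - sqWeight n| * (|sqWeight (n + v) - sqWeight n| / (k + 1)) :=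
          mul_le_mul_of_nonneg_left (abs_cutoff_sub_le k _ _) (abs_nonneg _)
      _ = (sqWeight (n + v) - sqWeight n) ^ 2 / (k + 1) := by
          rw [← mul_div_assoc, ← pow_two, sq_abs]
      _ ≤ 24 := by
          rw [div_le_iff₀ hk]
          have : (0 : ℝ) ≤ k := k.cast_nonneg
          linarith
  rcases le_or_gt (sqWeight n) (k + 1) with h | h
  · exact key _ h (sq_sqWeight_sub_le hv n)
  rcases le_or_gt (sqWeight (n + v)) (k + 1) with h' | h'
  · refine key _ h' ?_
    have hv' : -v ∈ nbrs := neg_mem_nbrs hv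
    have h2 := sq_sqWeight_sub_le hv' (n + v)
    rw [add_neg_cancel_right] at h2
    rwa [sub_sq_comm]
  · rw [cutoff_eq_zero h.le, cutoff_eq_zero h'.le]
    simp

/-- Dominated convergence in `ℓ²(ℤ²)`. -/
lemma tendsto_lp_of_dominated {u : ℕ → L2Lattice} {g : L2Lattice} {B : ℤ × ℤ → ℝ}
    (hB : Memℓp B 2) (hu : ∀ k n, ‖u k n - g n‖ ≤ B n)
    (hlim : ∀ n, Tendsto (fun k => u k n) atTop (𝓝 (g n))) : Tendsto u atTop (𝓝 g) := by
  have hB2 : Summable fun n => B n ^ 2 := by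
    simpa using (memℓp_gen_iff (by norm_num)).1 hB
  have h1 : Tendsto (fun k => ∑' n, ‖u k n - g n‖ ^ 2) atTop (𝓝 (∑' _ : ℤ × ℤ, (0 : ℝ))) := by
    refine tendsto_tsum_of_dominated_convergence hB2 (fun n => ?_)
      (Eventually.of_forall fun k n => ?_)
    · have := ((hlim n).sub_const (g n)).norm.pow 2
      simpa using this
    · rw [Real.norm_of_nonneg (by positivity)]
      exact pow_le_pow_left₀ (norm_nonneg _) (hu k n) 2
  have h2 : ∀ k, ‖u k - g‖ ^ 2 = ∑' n, ‖u k n - g n‖ ^ 2 := by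
    intro k
    have := lp.norm_rpow_eq_tsum (p := 2) (by norm_num) (u k - g)
    simpa using this
  rw [tsum_zero] at h1
  rw [tendsto_iff_norm_sub_tendsto_zero]
  have h3 := h1.sqrt
  rw [Real.sqrt_zero] at h3
  refine h3.congr fun k => ?_
  rw [← h2, Real.sqrt_sq (norm_nonneg _)]

lemma memlp_norm {f : ℤ × ℤ → ℂ} (hf : Memℓp f 2) : Memℓp (fun n => ‖f n‖) 2 := by
  rw [memℓp_gen_iff (by norm_num)] at hf ⊢
  simpa using hf

/-- The truncation of a sequence and its image under the conjugate operator. -/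
def truncation (k : ℕ) (f : L2Lattice) : L2Lattice × L2Lattice :=
  ∑ m ∈ Finset.Icc (-(k + 1) : ℤ) (k + 1) ×ˢ Finset.Icc (-(k + 1) : ℤ) (k + 1),
    ((cutoff k m : ℂ) * f m) • (delta m, conjDelta m)

lemma truncation_mem (k : ℕ) (f : L2Lattice) : truncation k f ∈ maximalGraph :=
  Submodule.sum_mem _ fun m _ => Submodule.smul_mem _ _ (delta_mem m)

lemma truncation_fst_apply (k : ℕ) (f : L2Lattice) (n : ℤ × ℤ) :
    (truncation k f).1 n = (cutoff k n : ℂ) * f n := by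
  rw [truncation, Prod.fst_sum, lp_sum_apply]
  have h : ∀ m, ((((cutoff k m : ℂ) * f m) • (delta m, conjDelta m)).1 : L2Lattice) n =
      if n = m then (cutoff k m : ℂ) * f m else 0 := by
    intro m
    change ((cutoff k m : ℂ) * f m) * delta m n = _
    rw [delta_apply, mul_ite, mul_one, mul_zero]
  simp only [h]
  rw [Finset.sum_ite_eq]
  split_ifs with hn
  · rfl
  · rw [cutoff_eq_zero, ofReal_zero, zero_mul]
    -- Where the cutoff is non-zero, `|n|² < k + 1`; integers satisfy `|nᵢ| ≤ nᵢ²`, so such `n` lie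
    -- in the summed square.
    by_contra hlt
    push Not at hlt
    apply hn
    have hz : n.1 ^ 2 + n.2 ^ 2 < k + 1 := by
      unfold sqWeight at hlt; exact_mod_cast hlt
    simp only [Finset.mem_product, Finset.mem_Icc]
    refine ⟨⟨?_, ?_⟩, ?_, ?_⟩ <;> nlinarith [sq_nonneg n.1, sq_nonneg n.2]

/-- The second component is the cutoff of `g` plus the commutator term. The latter has coefficients
at most `24/12 = 2` in modulus, tending to zero at each point, so dominated convergence applies to
both components. -/
lemma tendsto_truncation {f g : L2Lattice} (h : (f, g) ∈ maximalGraph) :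
    Tendsto (fun k => truncation k f) atTop (𝓝 (f, g)) := by
  have hcut : ∀ k n, ‖(cutoff k n : ℂ) - 1‖ ≤ 1 := fun k n => by
    rw [← ofReal_one, ← ofReal_sub, norm_real, Real.norm_eq_abs, abs_le]
    constructor <;> linarith [cutoff_nonneg k n, cutoff_le_one k n]
  have hcutlim : ∀ n, Tendsto (fun k => (cutoff k n : ℂ)) atTop (𝓝 1) := fun n => by
    rw [← ofReal_one]
    exact (continuous_ofReal.tendsto (1 : ℝ)).comp (tendsto_cutoff n)
  suffices Tendsto (fun k => (truncation k f).1) atTop (𝓝 f) ∧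
      Tendsto (fun k => (truncation k f).2) atTop (𝓝 g) from this.1.prodMk_nhds this.2
  constructor
  · refine tendsto_lp_of_dominated (memlp_norm (lp.memℓp f)) (fun k n => ?_) fun n => ?_
    · rw [truncation_fst_apply, ← sub_one_mul, norm_mul]
      exact mul_le_of_le_one_left (norm_nonneg _) (hcut k n)
    · simp only [truncation_fst_apply]
      simpa using (hcutlim n).mul_const (f n)
  · have hsnd : ∀ k n, (truncation k f).2 n = cutoff k n * g n + I / 12 * ∑ v ∈ nbrs,
        (((sqWeight (n + v) - sqWeight n) * (cutoff k (n + v) - cutoff k n) : ℝ) : ℂ) *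
          f (n + v) := by
      intro k n
      rw [truncation_mem k f n, conjFun_apply, mem_maximalGraph.1 h n, conjFun_apply,
        mul_left_comm, ← mul_add]
      congr 1
      rw [Finset.mul_sum, ← Finset.sum_add_distrib]
      refine Finset.sum_congr rfl fun v _ => ?_
      rw [truncation_fst_apply]
      push_cast
      ring
    have hB : Memℓp ((fun n => ‖g n‖) + ∑ v ∈ nbrs, fun n => 2 * ‖f (n + v)‖) 2 := by
      refine (memlp_norm (lp.memℓp g)).add ?_
      have : ∀ v ∈ nbrs, Memℓp (fun n => 2 * ‖f (n + v)‖) 2 := fun v _ =>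
        (memlp_norm (memlp_shift v f)).const_mul 2
      convert! Memℓp.finsetSum nbrs this using 1
    refine tendsto_lp_of_dominated hB (fun k n => ?_) fun n => ?_
    · rw [hsnd, add_sub_right_comm, ← sub_one_mul, Pi.add_apply, Finset.sum_apply]
      refine (norm_add_le _ _).trans (add_le_add ?_ ?_)
      · rw [norm_mul]
        exact mul_le_of_le_one_left (norm_nonneg _) (hcut k n)
      · rw [Finset.mul_sum]
        refine norm_sum_le_of_le _ fun v hv => ?_
        rw [norm_mul, norm_mul, norm_real, Real.norm_eq_abs, norm_div, norm_I, ← mul_assoc]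
        refine mul_le_mul_of_nonneg_right ?_ (norm_nonneg _)
        have := abs_mul_cutoff_sub_le hv k n
        rw [RCLike.norm_ofNat]
        linarith
    · simp only [hsnd]
      have h1 : ∀ v, Tendsto (fun k => (((sqWeight (n + v) - sqWeight n) *
          (cutoff k (n + v) - cutoff k n) : ℝ) : ℂ) * f (n + v)) atTop (𝓝 0) := by
        intro v
        have h2 := ((tendsto_cutoff (n + v)).sub (tendsto_cutoff n)).const_mul
          (sqWeight (n + v) - sqWeight n)
        rw [sub_self, mul_zero] at h2
        simpa using ((continuous_ofReal.tendsto (0 : ℝ)).comp h2).mul_const (f (n + v))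
      have h3 := ((hcutlim n).mul_const (g n)).add
        ((tendsto_finsetSum nbrs fun v _ => h1 v).const_mul (I / 12))
      simpa using h3

/-- The core property: truncations are finite combinations of the point-mass pairs and approximate
every pair of the maximal graph. -/
lemma maximalGraph_le {G : Submodule ℂ (L2Lattice × L2Lattice)}
    (hG : IsClosed (G : Set (L2Lattice × L2Lattice))) (h : ∀ m, (delta m, conjDelta m) ∈ G) :
    maximalGraph ≤ G := by
  rintro ⟨f, g⟩ hfg
  exact hG.mem_of_tendsto (tendsto_truncation hfg) (Eventually.of_forall fun k =>
    Submodule.sum_mem _ fun m _ => Submodule.smul_mem _ _ (h m))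

/-- Testing an adjoint pair on point masses recovers the defining equations. Conversely, for fixed
`(f, g)` symmetry is a closed linear condition on the other pair, so by the core property it need
only be checked on point masses. -/
lemma adjoint_maximalGraph : maximalGraph.adjoint = maximalGraph := by
  apply le_antisymm
  · rintro ⟨f, g⟩ hfg
    rw [mem_maximalGraph]
    intro m
    have h := (Submodule.mem_adjoint_iff _ _).1 hfg _ _ (delta_mem m)
    rw [inner_conjDelta, inner_delta] at h
    exact (sub_eq_zero.1 h).symm
  · rintro ⟨f, g⟩ hfg
    let L : L2Lattice × L2Lattice →L[ℂ] ℂ :=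
      innerSL ℂ f ∘L ContinuousLinearMap.snd ℂ L2Lattice L2Lattice -
        innerSL ℂ g ∘L ContinuousLinearMap.fst ℂ L2Lattice L2Lattice
    have hL : maximalGraph ≤ LinearMap.ker (L : L2Lattice × L2Lattice →ₗ[ℂ] ℂ) := by
      refine maximalGraph_le L.isClosed_ker fun m => ?_
      change ⟪f, conjDelta m⟫_ℂ - ⟪g, delta m⟫_ℂ = 0
      rw [← inner_conj_symm, inner_conjDelta, ← inner_conj_symm g, inner_delta,
        mem_maximalGraph.1 hfg, sub_self]
    rw [Submodule.mem_adjoint_iff]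
    intro a b hab
    have h : ⟪f, b⟫_ℂ - ⟪g, a⟫_ℂ = 0 := hL hab
    have h2 := congrArg (starRingEnd ℂ) h
    rwa [map_sub, inner_conj_symm, inner_conj_symm, map_zero] at h2

/-! ### Closures -/

section Core

variable {E : Type*} [NormedAddCommGroup E] [InnerProductSpace ℂ E]

/-- An operator which contains the finitely supported sequences and acts by `conjFun`, after
identification with `ℓ²(ℤ²)`, closes to the maximal operator. -/
lemma mem_graph_closure_iff (Φ : L2Lattice ≃ₗᵢ[ℂ] E) {T : E →ₗ.[ℂ] E}
    (hdelta : ∀ m, Φ (delta m) ∈ T.domain)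
    (hT : ∀ (f : T.domain) n, Φ.symm (T f) n = conjFun (Φ.symm f) n) (f g : E) :
    (f, g) ∈ T.closure.graph ↔ (Φ.symm f, Φ.symm g) ∈ maximalGraph := by
  have hle : ∀ p ∈ T.graph, (Φ.symm p.1, Φ.symm p.2) ∈ maximalGraph := by
    intro p hp
    obtain ⟨y, hy1, hy2⟩ := (LinearPMap.mem_graph_iff T).1 hp
    rw [← hy1, ← hy2, mem_maximalGraph]
    exact hT y
  have hcont : Continuous fun p : E × E => (Φ.symm p.1, Φ.symm p.2) := by fun_prop
  have hle' : ∀ p ∈ T.graph.topologicalClosure, (Φ.symm p.1, Φ.symm p.2) ∈ maximalGraph := by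
    intro p hp
    have h := map_mem_closure hcont (s := (T.graph : Set (E × E))) hp hle
    rwa [isClosed_maximalGraph.closure_eq] at h
  -- The closure of the graph stays inside the transported maximal graph, which is closed and
  -- single-valued.
  have hclosable : T.IsClosable := by
    refine ⟨T.graph.topologicalClosure.toLinearPMap,
      (Submodule.toLinearPMap_graph_eq _ fun p hp hp1 => ?_).symm⟩
    have h := hle' p hp
    rw [hp1, map_zero] at h
    exact Φ.symm.map_eq_zero_iff.1 (maximalGraph_unique h (Submodule.zero_mem _))
  rw [← hclosable.graph_closure_eq_closure_graph]
  refine ⟨fun h => hle' (f, g) h, fun h => ?_⟩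
  have hcont' : Continuous fun p : L2Lattice × L2Lattice => (Φ p.1, Φ p.2) := by fun_prop
  let Ψ : L2Lattice × L2Lattice →ₗ[ℂ] E × E :=
    (Φ.toLinearEquiv : L2Lattice →ₗ[ℂ] E).prodMap (Φ.toLinearEquiv : L2Lattice →ₗ[ℂ] E)
  -- For the reverse inclusion only point masses matter, and there single-valuedness forces the
  -- value of `T`.
  have hmax : maximalGraph ≤ T.graph.topologicalClosure.comap Ψ := by
    refine maximalGraph_le (T.graph.isClosed_topologicalClosure.preimage hcont') fun m => ?_
    refine T.graph.le_topologicalClosure ?_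
    have h1 := T.mem_graph ⟨_, hdelta m⟩
    have h2 := hle _ h1
    rw [Φ.symm_apply_apply] at h2
    have h3 : Φ.symm (T ⟨_, hdelta m⟩) = conjDelta m := maximalGraph_unique h2 (delta_mem m)
    rw [LinearIsometryEquiv.symm_apply_eq] at h3
    rw [h3] at h1
    exact h1
  have h1 : (Φ (Φ.symm f), Φ (Φ.symm g)) ∈ T.graph.topologicalClosure := hmax h
  rwa [Φ.apply_symm_apply, Φ.apply_symm_apply] at h1

end Core

lemma delta_mem_schwartz (m : ℤ × ℤ) : delta m ∈ schwartz := by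
  intro N
  refine ⟨‖(1 + (m.1 : ℂ) ^ 2 + (m.2 : ℂ) ^ 2) ^ N‖, fun n => ?_⟩
  change ‖(1 + (n.1 : ℂ) ^ 2 + (n.2 : ℂ) ^ 2) ^ N * delta m n‖ ≤ _
  rw [delta_apply]
  split_ifs with h
  · rw [h, mul_one]
  · rw [mul_zero, norm_zero]
    exact norm_nonneg _

lemma graph_conjugateOp : conjugateOp.graph = maximalGraph := by
  ext ⟨f, g⟩
  exact mem_graph_closure_iff (LinearIsometryEquiv.refl ℂ L2Lattice) (T := conjCore)
    delta_mem_schwartz (fun _ _ => rfl) f g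

/-! ### Commutators with shifts -/

/-- Finite linear combinations of translations. -/
def shiftSpan : Submodule ℂ (L2Lattice →L[ℂ] L2Lattice) :=
  Submodule.span ℂ (Set.range fun v => (shift v).toContinuousLinearMap)

lemma shift_mem_shiftSpan (v : ℤ × ℤ) : (shift v).toContinuousLinearMap ∈ shiftSpan :=
  Submodule.subset_span ⟨v, rfl⟩

lemma laplacian_mem_shiftSpan : laplacian ∈ shiftSpan := by
  unfold laplacian
  refine Submodule.smul_mem _ _ ?_
  repeat' first | exact shift_mem_shiftSpan _ | refine Submodule.add_mem _ ?_ ?_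

/-- The commutator of the conjugate operator with a translation. -/
def shiftCommutator (w : ℤ × ℤ) : L2Lattice →L[ℂ] L2Lattice :=
  ∑ v ∈ nbrs, (-(I / 6) * ((v.1 * w.1 + v.2 * w.2 : ℤ) : ℂ)) •
    (shift (w + v)).toContinuousLinearMap

/-- The coefficient is a mixed second difference of the quadratic `|n|²` in the directions `v` and
`w`: its dependence on `n` cancels, leaving `-2 v·w` times `i/12`. -/
lemma shift_commutator_mem (w : ℤ × ℤ) {f g : L2Lattice} (h : (f, g) ∈ maximalGraph) :
    (shift w f, shift w g + shiftCommutator w f) ∈ maximalGraph := by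
  rw [mem_maximalGraph]
  intro n
  have h1 : shiftCommutator w f n = ∑ v ∈ nbrs,
      (-(I / 6) * ((v.1 * w.1 + v.2 * w.2 : ℤ) : ℂ)) * f (n + (w + v)) := by
    rw [shiftCommutator, sum_apply, lp_sum_apply]
    rfl
  change g (n + w) + shiftCommutator w f n = _
  rw [h1, mem_maximalGraph.1 h, conjFun_apply, conjFun_apply, Finset.mul_sum, Finset.mul_sum,
    ← Finset.sum_add_distrib]
  refine Finset.sum_congr rfl fun v _ => ?_
  change _ = I / 12 * (_ * f (n + v + w))
  rw [← add_assoc, add_right_comm n v w]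
  simp only [sqWeight, Prod.fst_add, Prod.snd_add]
  push_cast
  ring

/-- Stability of the span means that all iterated commutators of `Δ_T` with `A` are bounded, which
gives every order of regularity. -/
lemma exists_commutator {H : L2Lattice →L[ℂ] L2Lattice} (hH : H ∈ shiftSpan) :
    ∃ K ∈ shiftSpan, ∀ f g, (f, g) ∈ maximalGraph → (H f, H g + K f) ∈ maximalGraph := by
  induction hH using Submodule.span_induction with
  | mem H hH =>
    obtain ⟨w, rfl⟩ := hH
    exact ⟨shiftCommutator w, Submodule.sum_mem _ fun v _ =>
      Submodule.smul_mem _ _ (shift_mem_shiftSpan _), fun f g => shift_commutator_mem w⟩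
  | zero => exact ⟨0, Submodule.zero_mem _, fun f g _ => by
    rw [zero_apply, zero_apply, add_zero]
    exact Submodule.zero_mem maximalGraph⟩
  | add H H' _ _ ih ih' =>
    obtain ⟨K, hK, h⟩ := ih
    obtain ⟨K', hK', h'⟩ := ih'
    refine ⟨K + K', Submodule.add_mem _ hK hK', fun f g hfg => ?_⟩
    have := Submodule.add_mem _ (h f g hfg) (h' f g hfg)
    rw [Prod.mk_add_mk, add_add_add_comm] at this
    exact this
  | smul c H _ ih =>
    obtain ⟨K, hK, h⟩ := ih
    refine ⟨c • K, Submodule.smul_mem _ _ hK, fun f g hfg => ?_⟩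
    have := Submodule.smul_mem _ c (h f g hfg)
    rw [Prod.smul_mk, smul_add] at this
    exact this

theorem isOfClass_laplacian (k : ℕ) : IsOfClass k laplacian conjugateOp := by
  have hadj : conjugateOp.graph.adjoint = conjugateOp.graph := by
    rw [graph_conjugateOp, adjoint_maximalGraph]
  obtain ⟨U, hU⟩ := exists_isUnitaryGroupOf hadj
  refine ⟨U, hU, hU.contDiff_conj (T := shiftSpan) (fun H hH => ?_)
    (dense_fst_of_adjoint_eq hadj fun g hg => LinearPMap.graph_fst_eq_zero_snd _ hg rfl) k
    laplacian laplacian_mem_shiftSpan⟩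
  rw [graph_conjugateOp]
  exact exists_commutator hH

/-! ## The Fourier side -/

lemma fourierTransform_symm_apply (f : L2Box) (n : ℤ × ℤ) :
    fourierTransform.symm f n = ⟪toL2 (expFun n), f⟫_ℂ := by
  have h : fourierTransform.symm f n = expBasis.repr f n := rfl
  rw [h, HilbertBasis.repr_apply_apply, expBasis, HilbertBasis.coe_mkOfOrthogonalEqBot]

lemma fourierTransform_delta (n : ℤ × ℤ) : fourierTransform (delta n) = toL2 (expFun n) := by
  have h : fourierTransform (delta n) = expBasis.repr.symm (lp.single 2 n 1) := rfl
  rw [h, HilbertBasis.repr_symm_single, expBasis, HilbertBasis.coe_mkOfOrthogonalEqBot]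

lemma expFun_apply (n : ℤ × ℤ) (x : ℝ × ℝ) : expFun n x =
    (1 / (2 * Real.pi) : ℂ) * exp (-I * ((n.1 : ℂ) * x.1 + (n.2 : ℂ) * x.2)) := rfl

lemma expFun_add (n v : ℤ × ℤ) (x : ℝ × ℝ) :
    expFun (n + v) x = exp (-I * ((v.1 : ℂ) * x.1 + (v.2 : ℂ) * x.2)) * expFun n x := by
  rw [expFun_apply, expFun_apply, mul_left_comm, ← exp_add]
  congr 2
  simp only [Prod.fst_add, Prod.snd_add]
  push_cast
  ring

/-! ### The Laplacian is multiplication by the symbol -/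

lemma laplacian_apply (f : L2Lattice) (n : ℤ × ℤ) :
    laplacian f n = 1 / 6 * ∑ v ∈ nbrs, f (n + v) := by
  rw [sum_nbrs]
  change 1 / 6 * (f (n + (1, 0)) + f (n + (-1, 0)) + f (n + (0, 1)) + f (n + (0, -1)) +
    f (n + (1, -1)) + f (n + (-1, 1))) = _
  ring

lemma symbolC_mul_expFun (n : ℤ × ℤ) (x : ℝ × ℝ) :
    (symbol x : ℂ) * expFun n x = 1 / 6 * ∑ v ∈ nbrs, expFun (n + v) x := by
  simp only [expFun_add, sum_nbrs, symbol]
  push_cast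
  simp only [Complex.cos]
  ring_nf

lemma symbol_abs_le (x : ℝ × ℝ) : ‖(symbol x : ℂ)‖ ≤ 1 := by
  rw [norm_real, Real.norm_eq_abs, symbol, abs_le]
  have h1 := Real.neg_one_le_cos x.1
  have h2 := Real.neg_one_le_cos x.2
  have h3 := Real.neg_one_le_cos (x.1 - x.2)
  have h4 := Real.cos_le_one x.1
  have h5 := Real.cos_le_one x.2
  have h6 := Real.cos_le_one (x.1 - x.2)
  constructor <;> linarith

lemma memLp_symbol_mul (f : L2Box) : MemLp (fun x => (symbol x : ℂ) * f x) 2 boxMeasure := by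
  refine (Lp.memLp f).of_le (contDiff_symbolC.continuous.aestronglyMeasurable.mul
    (Lp.aestronglyMeasurable f)) (Eventually.of_forall fun x => ?_)
  rw [norm_mul]
  exact mul_le_of_le_one_left (norm_nonneg _) (symbol_abs_le x)

lemma inner_toL2 (e : C(ℝ × ℝ, ℂ)) {f : L2Box} {g : ℝ × ℝ → ℂ} (hg : f =ᵐ[boxMeasure] g) :
    ⟪toL2 e, f⟫_ℂ = ∫ x, starRingEnd ℂ (e x) * g x ∂boxMeasure := by
  rw [L2.inner_def]
  refine integral_congr_ae ?_
  filter_upwards [coeFn_toL2 e, hg] with x h1 h2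
  rw [h1, h2, RCLike.inner_apply, mul_comm]

/-- Fourier coefficients are compared: the symbol is real, so it moves onto the exponential, where
each cosine yields a pair of opposite neighbours. -/
lemma laplacianHat_eq (f : L2Box) : laplacianHat f = (memLp_symbol_mul f).toLp _ := by
  change fourierTransform (laplacian (fourierTransform.symm f)) = _
  rw [← LinearIsometryEquiv.eq_symm_apply]
  ext n
  rw [laplacian_apply, fourierTransform_symm_apply,
    inner_toL2 _ (memLp_symbol_mul f).coeFn_toLp]
  have h : ∀ x, starRingEnd ℂ (expFun n x) * ((symbol x : ℂ) * f x) =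
      starRingEnd ℂ ((1 / 6 : ℂ) * ∑ v ∈ nbrs, expFun (n + v) x) * f x := by
    intro x
    rw [← symbolC_mul_expFun, map_mul, conj_ofReal]
    ring
  have h3 := inner_toL2 ((1 / 6 : ℂ) • ∑ v ∈ nbrs, expFun (n + v)) (ae_eq_refl f)
  rw [map_smul, map_sum, inner_smul_left, sum_inner] at h3
  simp only [← fourierTransform_symm_apply] at h3
  simp only [map_div₀, map_one, map_ofNat] at h3
  rw [h3]
  refine integral_congr_ae (Eventually.of_forall fun x => ?_)
  simp only [h]
  simp [ContinuousMap.smul_apply, ContinuousMap.sum_apply]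

/-! ### Integration by parts -/

/-- Integrating in the first variable first leaves a difference of boundary values, which is zero by
periodicity. -/
lemma integral_box_pd₁ {g : ℝ × ℝ → ℂ} (hg : g ∈ smoothPer) :
    ∫ x, pd₁ g x ∂boxMeasure = 0 := by
  have hpi : -Real.pi ≤ Real.pi := by linarith [Real.pi_pos]
  have hint : IntegrableOn (pd₁ g) box (volume.prod volume) :=
    (contDiff_pd₁ hg.1).continuous.continuousOn.integrableOn_compact isCompact_box
  have hd : ∀ x y : ℝ, HasDerivAt (fun s => g (s, y)) (pd₁ g (x, y)) x := fun x y =>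
    (hg.1.differentiable (by simp) (x, y)).hasFDerivAt.comp_hasDerivAt x
      ((hasDerivAt_id x).prodMk (hasDerivAt_const x y))
  rw [boxMeasure, Measure.volume_eq_prod, box, ← Measure.prod_restrict, integral_prod_symm]
  · refine integral_eq_zero_of_ae (Eventually.of_forall fun y => ?_)
    simp only [Pi.zero_apply]
    rw [integral_Icc_eq_integral_Ioc, ← intervalIntegral.integral_of_le hpi,
      intervalIntegral.integral_eq_sub_of_hasDerivAt (fun x _ => hd x y)
        (((contDiff_pd₁ hg.1).continuous.comp (by fun_prop : Continuous fun x : ℝ =>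
          (x, y))).intervalIntegrable _ _)]
    have := hg.2.1 (-Real.pi) y
    rw [← this, sub_eq_zero]
    congr 2
    ring
  · rw [Measure.prod_restrict]
    exact hint

lemma integral_box_pd₂ {g : ℝ × ℝ → ℂ} (hg : g ∈ smoothPer) :
    ∫ x, pd₂ g x ∂boxMeasure = 0 := by
  have hpi : -Real.pi ≤ Real.pi := by linarith [Real.pi_pos]
  have hint : IntegrableOn (pd₂ g) box (volume.prod volume) :=
    (contDiff_pd₂ hg.1).continuous.continuousOn.integrableOn_compact isCompact_box
  have hd : ∀ x y : ℝ, HasDerivAt (fun s => g (x, s)) (pd₂ g (x, y)) y := fun x y =>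
    (hg.1.differentiable (by simp) (x, y)).hasFDerivAt.comp_hasDerivAt y
      ((hasDerivAt_const y x).prodMk (hasDerivAt_id y))
  rw [boxMeasure, Measure.volume_eq_prod, box, setIntegral_prod _ hint]
  refine integral_eq_zero_of_ae (Eventually.of_forall fun x => ?_)
  simp only [Pi.zero_apply]
  rw [integral_Icc_eq_integral_Ioc, ← intervalIntegral.integral_of_le hpi,
    intervalIntegral.integral_eq_sub_of_hasDerivAt (fun y _ => hd x y)
      (((contDiff_pd₂ hg.1).continuous.comp (by fun_prop : Continuous fun y : ℝ =>
        (x, y))).intervalIntegrable _ _)]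
  have := hg.2.2 x (-Real.pi)
  rw [← this, sub_eq_zero]
  congr 2
  ring

/-! ### Calculus of smooth periodic functions -/

lemma pd₁_eq_of_hasDerivAt {g : ℝ × ℝ → ℂ} (hg : ContDiff ℝ ∞ g) {x : ℝ × ℝ} {d : ℂ}
    (h : HasDerivAt (fun s => g (s, x.2)) d x.1) : pd₁ g x = d := by
  have h1 := (hg.differentiable (by simp) x).hasFDerivAt.comp_hasDerivAt (x := x.1)
    (f := fun s => (s, x.2)) ((hasDerivAt_id x.1).prodMk (hasDerivAt_const x.1 x.2))
  exact h1.unique h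

lemma pd₂_eq_of_hasDerivAt {g : ℝ × ℝ → ℂ} (hg : ContDiff ℝ ∞ g) {x : ℝ × ℝ} {d : ℂ}
    (h : HasDerivAt (fun s => g (x.1, s)) d x.2) : pd₂ g x = d := by
  have h1 := (hg.differentiable (by simp) x).hasFDerivAt.comp_hasDerivAt (x := x.2)
    (f := fun s => (x.1, s)) ((hasDerivAt_const x.2 x.1).prodMk (hasDerivAt_id x.2))
  exact h1.unique h

lemma pd₁_mul {f g : ℝ × ℝ → ℂ} (hf : ContDiff ℝ ∞ f) (hg : ContDiff ℝ ∞ g) (x : ℝ × ℝ) :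
    pd₁ (fun y => f y * g y) x = pd₁ f x * g x + f x * pd₁ g x := by
  unfold pd₁
  rw [fderiv_fun_mul (hf.differentiable (by simp) x) (hg.differentiable (by simp) x)]
  simp only [add_apply, smul_apply, smul_eq_mul]
  ring

lemma pd₂_mul {f g : ℝ × ℝ → ℂ} (hf : ContDiff ℝ ∞ f) (hg : ContDiff ℝ ∞ g) (x : ℝ × ℝ) :
    pd₂ (fun y => f y * g y) x = pd₂ f x * g x + f x * pd₂ g x := by
  unfold pd₂
  rw [fderiv_fun_mul (hf.differentiable (by simp) x) (hg.differentiable (by simp) x)]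
  simp only [add_apply, smul_apply, smul_eq_mul]
  ring

lemma fderiv_star {g : ℝ × ℝ → ℂ} (hg : ContDiff ℝ ∞ g) (x v : ℝ × ℝ) :
    fderiv ℝ (fun y => starRingEnd ℂ (g y)) x v = starRingEnd ℂ (fderiv ℝ g x v) := by
  have h := (conjCLE : ℂ →L[ℝ] ℂ).hasFDerivAt.comp x
    (hg.differentiable (by simp) x).hasFDerivAt
  have h2 : HasFDerivAt (fun y => starRingEnd ℂ (g y)) _ x := h
  rw [h2.fderiv]
  rfl

lemma pd₁_star {g : ℝ × ℝ → ℂ} (hg : ContDiff ℝ ∞ g) (x : ℝ × ℝ) :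
    pd₁ (fun y => starRingEnd ℂ (g y)) x = starRingEnd ℂ (pd₁ g x) := fderiv_star hg x _

lemma pd₂_star {g : ℝ × ℝ → ℂ} (hg : ContDiff ℝ ∞ g) (x : ℝ × ℝ) :
    pd₂ (fun y => starRingEnd ℂ (g y)) x = starRingEnd ℂ (pd₂ g x) := fderiv_star hg x _

lemma smoothPer_mul {f g : ℝ × ℝ → ℂ} (hf : f ∈ smoothPer) (hg : g ∈ smoothPer) :
    (fun y => f y * g y) ∈ smoothPer :=
  ⟨hf.1.mul hg.1, fun x y => by simp only [hf.2.1 x y, hg.2.1 x y],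
    fun x y => by simp only [hf.2.2 x y, hg.2.2 x y]⟩

lemma smoothPer_star {g : ℝ × ℝ → ℂ} (hg : g ∈ smoothPer) :
    (fun y => starRingEnd ℂ (g y)) ∈ smoothPer :=
  ⟨(conjCLE : ℂ →L[ℝ] ℂ).contDiff.comp hg.1, fun x y => by simp only [hg.2.1 x y],
    fun x y => by simp only [hg.2.2 x y]⟩

lemma fderiv_add_period {g : ℝ × ℝ → ℂ} {a : ℝ × ℝ} (h : ∀ x, g (x + a) = g x) (x : ℝ × ℝ) :
    fderiv ℝ g (x + a) = fderiv ℝ g x := by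
  rw [← fderiv_comp_add_right]
  simp only [h]

lemma fderiv_period_fst {g : ℝ × ℝ → ℂ} (hg : g ∈ smoothPer) (x y : ℝ) :
    fderiv ℝ g (x + 2 * Real.pi, y) = fderiv ℝ g (x, y) := by
  have := fderiv_add_period (g := g) (a := (2 * Real.pi, 0))
    (fun ⟨a, b⟩ => by simpa using hg.2.1 a b) (x, y)
  simpa using this

lemma fderiv_period_snd {g : ℝ × ℝ → ℂ} (hg : g ∈ smoothPer) (x y : ℝ) :
    fderiv ℝ g (x, y + 2 * Real.pi) = fderiv ℝ g (x, y) := by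
  have := fderiv_add_period (g := g) (a := (0, 2 * Real.pi))
    (fun ⟨a, b⟩ => by simpa using hg.2.2 a b) (x, y)
  simpa using this

lemma smoothPer_pd₁ {g : ℝ × ℝ → ℂ} (hg : g ∈ smoothPer) : pd₁ g ∈ smoothPer :=
  ⟨contDiff_pd₁ hg.1, fun x y => by simp only [pd₁, fderiv_period_fst hg],
    fun x y => by simp only [pd₁, fderiv_period_snd hg]⟩

lemma smoothPer_pd₂ {g : ℝ × ℝ → ℂ} (hg : g ∈ smoothPer) : pd₂ g ∈ smoothPer :=
  ⟨contDiff_pd₂ hg.1, fun x y => by simp only [pd₂, fderiv_period_fst hg],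
    fun x y => by simp only [pd₂, fderiv_period_snd hg]⟩

lemma symbolC_mem_smoothPer : symbolC ∈ smoothPer := by
  refine ⟨contDiff_symbolC, fun x y => ?_, fun x y => ?_⟩
  · simp only [symbolC, symbol, Real.cos_add_two_pi, add_sub_right_comm]
  · simp only [symbolC, symbol, Real.cos_add_two_pi, ← sub_sub, Real.cos_sub_two_pi]

lemma expFun_mem_smoothPer (n : ℤ × ℤ) : (expFun n : ℝ × ℝ → ℂ) ∈ smoothPer := by
  refine ⟨?_, fun x y => ?_, fun x y => ?_⟩
  · have h : (expFun n : ℝ × ℝ → ℂ) = fun x : ℝ × ℝ => (1 / (2 * Real.pi) : ℂ) *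
        exp (-I * ((n.1 : ℂ) * ofRealCLM x.1 + (n.2 : ℂ) * ofRealCLM x.2)) := rfl
    rw [h]
    fun_prop
  · rw [expFun_apply, expFun_apply]
    congr 1
    rw [exp_eq_exp_iff_exists_int]
    refine ⟨-n.1, ?_⟩
    push_cast
    ring
  · rw [expFun_apply, expFun_apply]
    congr 1
    rw [exp_eq_exp_iff_exists_int]
    refine ⟨-n.2, ?_⟩
    push_cast
    ring

/-! ### Symmetry of the differential expression -/

lemma conjHatFun_eq {g : ℝ × ℝ → ℂ} (hg : ContDiff ℝ ∞ g) (x : ℝ × ℝ) :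
    conjHatFun g x = I / 2 * (2 * (pd₁ symbolC x * pd₁ g x + pd₂ symbolC x * pd₂ g x) +
      (pd₁ (pd₁ symbolC) x + pd₂ (pd₂ symbolC) x) * g x) := by
  rw [conjHatFun, pd₁_mul (contDiff_pd₁ contDiff_symbolC) hg,
    pd₂_mul (contDiff_pd₂ contDiff_symbolC) hg]
  ring

/-- `F` is real and conjugation flips the sign of `i`, so the two terms add up, by the product rule,
to `i` times the divergence of `ē g ∇F`. Its integral over a period vanishes. -/
lemma conjHatFun_divergence {e g : ℝ × ℝ → ℂ} (he : ContDiff ℝ ∞ e) (hg : ContDiff ℝ ∞ g)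
    (x : ℝ × ℝ) :
    starRingEnd ℂ (e x) * conjHatFun g x - starRingEnd ℂ (conjHatFun e x) * g x =
      I * (pd₁ (fun y => pd₁ symbolC y * (starRingEnd ℂ (e y) * g y)) x +
        pd₂ (fun y => pd₂ symbolC y * (starRingEnd ℂ (e y) * g y)) x) := by
  have hs := contDiff_symbolC
  have he' : ContDiff ℝ ∞ fun y => starRingEnd ℂ (e y) := (conjCLE : ℂ →L[ℝ] ℂ).contDiff.comp he
  have hreal : (fun y => starRingEnd ℂ (symbolC y)) = symbolC :=
    funext fun y => conj_ofReal _
  have h1 : ∀ y, starRingEnd ℂ (pd₁ symbolC y) = pd₁ symbolC y := fun y => by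
    rw [← pd₁_star hs, hreal]
  have h2 : ∀ y, starRingEnd ℂ (pd₂ symbolC y) = pd₂ symbolC y := fun y => by
    rw [← pd₂_star hs, hreal]
  have h11 : starRingEnd ℂ (pd₁ (pd₁ symbolC) x) = pd₁ (pd₁ symbolC) x := by
    rw [← pd₁_star (contDiff_pd₁ hs), funext h1]
  have h22 : starRingEnd ℂ (pd₂ (pd₂ symbolC) x) = pd₂ (pd₂ symbolC) x := by
    rw [← pd₂_star (contDiff_pd₂ hs), funext h2]
  rw [conjHatFun_eq hg, conjHatFun_eq he, pd₁_mul (contDiff_pd₁ hs) (he'.mul hg),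
    pd₂_mul (contDiff_pd₂ hs) (he'.mul hg), pd₁_mul he' hg, pd₂_mul he' hg, pd₁_star he,
    pd₂_star he]
  simp only [map_mul, map_add, map_div₀, conj_I, map_ofNat, h1, h2, h11, h22]
  ring

lemma integrable_box {g : ℝ × ℝ → ℂ} (hg : Continuous g) : Integrable g boxMeasure :=
  hg.continuousOn.integrableOn_compact isCompact_box

lemma integral_conjHatFun_symm {e g : ℝ × ℝ → ℂ} (he : e ∈ smoothPer) (hg : g ∈ smoothPer) :
    ∫ x, starRingEnd ℂ (e x) * conjHatFun g x ∂boxMeasure =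
      ∫ x, starRingEnd ℂ (conjHatFun e x) * g x ∂boxMeasure := by
  have hce := (contDiff_conjHatFun he.1).continuous
  have hcg := (contDiff_conjHatFun hg.1).continuous
  have hec := he.1.continuous
  have hgc := hg.1.continuous
  have hp := smoothPer_mul (smoothPer_star he) hg
  have hp₁ := smoothPer_mul (smoothPer_pd₁ symbolC_mem_smoothPer) hp
  have hp₂ := smoothPer_mul (smoothPer_pd₂ symbolC_mem_smoothPer) hp
  have hi₁ : Integrable (fun x => starRingEnd ℂ (e x) * conjHatFun g x) boxMeasure :=
    integrable_box ((Complex.continuous_conj.comp hec).mul hcg)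
  have hi₂ : Integrable (fun x => starRingEnd ℂ (conjHatFun e x) * g x) boxMeasure :=
    integrable_box ((Complex.continuous_conj.comp hce).mul hgc)
  rw [← sub_eq_zero, ← integral_sub hi₁ hi₂]
  simp only [conjHatFun_divergence he.1 hg.1]
  rw [integral_const_mul, integral_add (integrable_box (contDiff_pd₁ hp₁.1).continuous)
    (integrable_box (contDiff_pd₂ hp₂.1).continuous), integral_box_pd₁ hp₁, integral_box_pd₂ hp₂,
    add_zero, mul_zero]

/-! ### The differential expression on exponentials -/

lemma hasDerivAt_expFun_fst (n : ℤ × ℤ) (x : ℝ × ℝ) :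
    HasDerivAt (fun s => expFun n (s, x.2)) (-I * n.1 * expFun n x) x.1 := by
  have h1 : HasDerivAt (fun s : ℝ => -I * ((n.1 : ℂ) * (s : ℂ) + (n.2 : ℂ) * (x.2 : ℂ)))
      (-I * ((n.1 : ℂ) * 1)) x.1 :=
    (((hasDerivAt_id x.1).ofReal_comp.const_mul (n.1 : ℂ)).add_const _).const_mul (-I)
  have h2 := h1.cexp.const_mul (1 / (2 * Real.pi) : ℂ)
  convert! h2 using 1
  rw [expFun_apply]
  ring

lemma hasDerivAt_expFun_snd (n : ℤ × ℤ) (x : ℝ × ℝ) :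
    HasDerivAt (fun s => expFun n (x.1, s)) (-I * n.2 * expFun n x) x.2 := by
  have h1 : HasDerivAt (fun s : ℝ => -I * ((n.1 : ℂ) * (x.1 : ℂ) + (n.2 : ℂ) * (s : ℂ)))
      (-I * ((n.2 : ℂ) * 1)) x.2 :=
    (((hasDerivAt_id x.2).ofReal_comp.const_mul (n.2 : ℂ)).const_add _).const_mul (-I)
  have h2 := h1.cexp.const_mul (1 / (2 * Real.pi) : ℂ)
  convert! h2 using 1
  rw [expFun_apply]
  ring

lemma contDiff_sum_expFun (c : ℤ × ℤ → ℂ) (n : ℤ × ℤ) :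
    ContDiff ℝ ∞ fun y => ∑ v ∈ nbrs, c v * expFun (n + v) y :=
  ContDiff.sum fun v _ => contDiff_const.mul (expFun_mem_smoothPer (n + v)).1

lemma pd₁_sum_expFun (c : ℤ × ℤ → ℂ) (n : ℤ × ℤ) (x : ℝ × ℝ) :
    pd₁ (fun y => ∑ v ∈ nbrs, c v * expFun (n + v) y) x =
      ∑ v ∈ nbrs, c v * (-I * (n + v).1 * expFun (n + v) x) :=
  pd₁_eq_of_hasDerivAt (contDiff_sum_expFun c n)
    (HasDerivAt.fun_sum fun v _ => (hasDerivAt_expFun_fst (n + v) x).const_mul (c v))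

lemma pd₂_sum_expFun (c : ℤ × ℤ → ℂ) (n : ℤ × ℤ) (x : ℝ × ℝ) :
    pd₂ (fun y => ∑ v ∈ nbrs, c v * expFun (n + v) y) x =
      ∑ v ∈ nbrs, c v * (-I * (n + v).2 * expFun (n + v) x) :=
  pd₂_eq_of_hasDerivAt (contDiff_sum_expFun c n)
    (HasDerivAt.fun_sum fun v _ => (hasDerivAt_expFun_snd (n + v) x).const_mul (c v))

lemma expFun_zero_mul (n v : ℤ × ℤ) (x : ℝ × ℝ) :
    2 * Real.pi * expFun (0 + v) x * expFun n x = expFun (n + v) x := by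
  have hpi : (Real.pi : ℂ) ≠ 0 := by exact_mod_cast Real.pi_ne_zero
  rw [expFun_add, expFun_add, expFun_apply 0]
  simp only [Prod.fst_zero, Prod.snd_zero, Int.cast_zero, zero_mul, add_zero, mul_zero, exp_zero]
  field_simp

/-- The constant `π/3` is `1/6` times the `2π` that undoes the normalisation of `expFun`; in this
form `F` is differentiated term by term. -/
lemma symbolC_eq_sum : symbolC = fun x => ∑ v ∈ nbrs, (Real.pi / 3 : ℂ) * expFun (0 + v) x := by
  have hpi : (Real.pi : ℂ) ≠ 0 := by exact_mod_cast Real.pi_ne_zero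
  ext x
  have h := symbolC_mul_expFun 0 x
  have h0 : expFun 0 x = (1 / (2 * Real.pi) : ℂ) := by simp [expFun_apply]
  rw [h0] at h
  rw [← Finset.mul_sum, symbolC]
  field_simp at h
  linear_combination h / 6

lemma pd₁_symbolC_mul_expFun (n : ℤ × ℤ) (x : ℝ × ℝ) :
    pd₁ symbolC x * expFun n x = ∑ v ∈ nbrs, (-(I / 6) * v.1) * expFun (n + v) x := by
  rw [symbolC_eq_sum, pd₁_sum_expFun, Finset.sum_mul]
  refine Finset.sum_congr rfl fun v _ => ?_
  rw [← expFun_zero_mul n v, zero_add]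
  ring

lemma pd₂_symbolC_mul_expFun (n : ℤ × ℤ) (x : ℝ × ℝ) :
    pd₂ symbolC x * expFun n x = ∑ v ∈ nbrs, (-(I / 6) * v.2) * expFun (n + v) x := by
  rw [symbolC_eq_sum, pd₂_sum_expFun, Finset.sum_mul]
  refine Finset.sum_congr rfl fun v _ => ?_
  rw [← expFun_zero_mul n v, zero_add]
  ring

/-- The two orderings in `Â` contribute `n·v` and `(n+v)·v`, whose sum is `|n+v|² - |n|²`. -/
lemma conjHatFun_expFun (n : ℤ × ℤ) (x : ℝ × ℝ) : conjHatFun (expFun n) x =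
    ∑ v ∈ nbrs, (-(I / 12) * ((sqWeight (n + v) - sqWeight n : ℝ) : ℂ)) * expFun (n + v) x := by
  have h1 : pd₁ (expFun n) x = -I * n.1 * expFun n x :=
    pd₁_eq_of_hasDerivAt (expFun_mem_smoothPer n).1 (hasDerivAt_expFun_fst n x)
  have h2 : pd₂ (expFun n) x = -I * n.2 * expFun n x :=
    pd₂_eq_of_hasDerivAt (expFun_mem_smoothPer n).1 (hasDerivAt_expFun_snd n x)
  have h3 : ∀ a : ℂ, pd₁ symbolC x * (a * expFun n x) = a * (pd₁ symbolC x * expFun n x) :=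
    fun a => mul_left_comm _ _ _
  have h4 : ∀ a : ℂ, pd₂ symbolC x * (a * expFun n x) = a * (pd₂ symbolC x * expFun n x) :=
    fun a => mul_left_comm _ _ _
  rw [conjHatFun, h1, h2, h3, h4]
  simp only [pd₁_symbolC_mul_expFun, pd₂_symbolC_mul_expFun]
  rw [pd₁_sum_expFun, pd₂_sum_expFun, Finset.mul_sum, Finset.mul_sum, ← Finset.sum_add_distrib,
    ← Finset.sum_add_distrib, ← Finset.sum_add_distrib, Finset.mul_sum]
  refine Finset.sum_congr rfl fun v _ => ?_
  simp only [sqWeight, Prod.fst_add, Prod.snd_add]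
  push_cast
  ring_nf
  simp only [I_pow_three]
  ring

/-! ### The closure of the differential operator -/

/-- Symmetry moves `Â` onto the exponential, and conjugation turns its coefficient `-i/12` into the
`i/12` of `conjFun_apply`. -/
lemma fourierTransform_symm_conjHat (g : smoothPer) (n : ℤ × ℤ) :
    fourierTransform.symm (conjHatToL2 g) n =
      conjFun (fourierTransform.symm (smoothPerToL2 g)) n := by
  have hcont : ∀ h : smoothPer, Continuous (h : ℝ × ℝ → ℂ) := fun h => h.2.1.continuous
  have h1 : fourierTransform.symm (conjHatToL2 g) n =
      ∫ x, starRingEnd ℂ (expFun n x) * conjHatFun g x ∂boxMeasure := by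
    rw [fourierTransform_symm_apply]
    exact inner_toL2 _ (coeFn_toL2 _)
  have h2 : ∀ m, fourierTransform.symm (smoothPerToL2 g) m =
      ∫ x, starRingEnd ℂ (expFun m x) * (g : ℝ × ℝ → ℂ) x ∂boxMeasure := fun m => by
    rw [fourierTransform_symm_apply]
    exact inner_toL2 _ (coeFn_toL2 _)
  rw [h1, integral_conjHatFun_symm (expFun_mem_smoothPer n) g.2, conjFun_apply]
  simp only [h2, conjHatFun_expFun, map_sum, Finset.sum_mul]
  rw [integral_finsetSum, Finset.mul_sum]
  · refine Finset.sum_congr rfl fun v _ => ?_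
    rw [← mul_assoc, ← integral_const_mul]
    refine integral_congr_ae (Eventually.of_forall fun x => ?_)
    simp only [map_mul, map_neg, map_div₀, conj_I, map_ofNat, conj_ofReal]
    ring
  · refine fun v _ => integrable_box ?_
    exact (Complex.continuous_conj.comp (continuous_const.mul
      (expFun (n + v)).continuous)).mul (hcont g)

lemma graph_conjugateOpHat (f g : L2Box) : (f, g) ∈ conjugateOpHat.graph ↔
    (fourierTransform.symm f, fourierTransform.symm g) ∈ conjugateOp.graph := by
  rw [graph_conjugateOp]
  refine mem_graph_closure_iff fourierTransform (T := conjHatCore) (fun m => ?_) ?_ f g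
  · rw [fourierTransform_delta]
    exact ⟨⟨expFun m, expFun_mem_smoothPer m⟩, rfl⟩
  · rintro ⟨f, g, rfl⟩ n
    have h : (LinearEquiv.ofInjective smoothPerToL2 smoothPerToL2_injective).symm
        ⟨smoothPerToL2 g, ⟨g, rfl⟩⟩ = g :=
      (LinearEquiv.symm_apply_eq _).2 rfl
    have h2 : conjHatCore ⟨smoothPerToL2 g, ⟨g, rfl⟩⟩ = conjHatToL2 g := by
      change conjHatToL2 ((LinearEquiv.ofInjective smoothPerToL2 smoothPerToL2_injective).symm
        ⟨smoothPerToL2 g, ⟨g, rfl⟩⟩) = _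
      rw [h]
    rw [h2]
    exact fourierTransform_symm_conjHat g n

end TriLattice

end

theorem proposition3p8 :
    (∀ f : TriLattice.L2Box, ∀ᵐ x ∂TriLattice.boxMeasure,
      TriLattice.laplacianHat f x = (TriLattice.symbol x : ℂ) * f x) ∧
    TriLattice.IsOfClass 2 TriLattice.laplacianHat TriLattice.conjugateOpHat ∧
    TriLattice.IsOfClass 2 TriLattice.laplacian TriLattice.conjugateOp := by
  refine ⟨fun f => ?_, ?_, TriLattice.isOfClass_laplacian 2⟩
  · rw [TriLattice.laplacianHat_eq]
    exact (TriLattice.memLp_symbol_mul f).coeFn_toLp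
  -- `laplacianHat` is by definition the conjugate of `laplacian` by `fourierTransform`, so the
  -- class is transported.
  · exact (TriLattice.isOfClass_laplacian 2).conj TriLattice.fourierTransform
      TriLattice.graph_conjugateOpHat
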